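/- **Setting.** Let $f:\mathbb{R}^{n}\times\mathbb{R}^{m}\to\mathbb{R}^n$ be three times continuously differentiable and let $\mathcal U=\langle u^c,G_U\rangle_Z\subset\mathbb{R}^m$ be a zonotope, where $\langle c,G\rangle_Z=\{c+\sum_j\beta_jG_{(\cdot,j)}\mid\beta_j\in[-1,1]\}$; put $\mathcal U^\Delta=\langle 0,G_U\rangle_Z$. For $\mathcal X\subset\mathbb{R}^n$ let $\mathcal R^e_{\mathcal X}(t)$ be the set of all $x(t)$, where $x$ is a continuous solution on $[0,t]$ of $\dot x=f(x,u)$ (in integrated form), $x(0)\in\mathcal X$, for some measurable $u$ with $u(\tau)\in\mathcal U$ for all $\tau\in[0,t]$. A polynomial zonotope $\mathcal{PZ}=\langle G,G_I,E\rangle_{PZ}$ with $p$ dependent factors is the union over $\alpha\in[-1,1]^p$ of the sets $\mathrm{eval}_{\mathcal{PZ}}(\alpha)=\big\langle\sum_i\big(\prod_{k=1}^p\alpha_k^{E_{(k,i)}}\big)G_{(\cdot,i)},\,G_I\big\rangle_Z$. The Minkowski sum $\oplus$ and the Cartesian product $\times$ with a zonotope introduce new independent generators; the exact addition $\boxplus$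 is the sum of two polynomial zonotopes that share the dependent factors: generators and exponents are concatenated. $\mathrm{zono}(\mathcal{PZ})$ is the zonotope obtained by replacing every monomial that is constant, has only even exponents, or is any other one, by its range $\{1\}$, $[0,1]$, $[-1,1]$, respectively. $\mathrm{sq}(D,\mathcal{PZ})$ encloses $\{(s^TD_is)_i\mid s\in\mathcal{PZ}\}$: the product is expanded, and the terms that contain independent factors are enclosed by $\mathrm{zono}$. $\mathrm{reduce}(\mathcal{PZ},\rho_d)$ encloses the $a=\max(0,\min(N,\lceil N-n(\rho_d-1)+1\rceil))$ shortest of the $N$ generators by the axis-aligned box around their $\mathrm{zono}$. $\mathrm{enlarge}(\Psi,\lambda)$ is $\mathrm{zono}(\Psi)$ with its generators multiplied by $\lambda$. **Algorithm** $\mathrm{reach}(\mathcal X_0,\Psi_s,z_s^*)$. Parameters: time horizon $t_f$, step size $r>0$ with $t_f=Nr$ for some $N\in\mathbb{N}$, factor $\lambda\in\mathbb{R}$, order $\rho_d\in\mathbb{R}$, number $\eta\in\mathbb{N}$ of Taylor terms, expansion points $z_s^*\in\mathbb{R}^{n+m}$. Start with $\mathcal R(t_0)=\mathcal X_0$, $t_0=0$,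 $s=0$. While $t_s<t_f$: 1. Write the second-order Taylor polynomial of $f$ at $z_s^*$, in powers of $z=[x\ u]$, as $w+Ax+Bu+\frac12(z^TD_iz)_i$, and put $\mathcal V=w\oplus Bu^c\oplus\frac12\mathrm{sq}(D,\mathcal R(t_s)\times\mathcal U)$. 2. Starting with $\Psi=\Psi_s$, repeat: $\overline\Psi:=\mathrm{enlarge}(\Psi,\lambda)$, $\Psi^\Delta:=\mathrm{abstrErr}(\mathcal R(t_s),\overline\Psi)$, $\Psi:=\mathcal V\oplus\Psi^\Delta$; until $\Psi\subseteq\overline\Psi$. 3. $\mathcal R(t_{s+1})=\mathrm{reduce}\big((e^{Ar}\mathcal R(t_s)\boxplus\Gamma(r)\mathcal V)\oplus\mathcal R^{p,\Delta}(\Psi^\Delta),\rho_d\big)$ with $\Gamma(r)=\int_0^re^{A(r-t)}dt$; then $t_{s+1}=t_s+r$, $s:=s+1$. The result is the last $\mathcal R(t_s)$. Let $|A|$ be the entrywise absolute value and $W=e^{|A|r}-\sum_{i\le\eta}\frac{r^i}{i!}|A|^i$. An interval matrix $[C-\Delta,C+\Delta]$ times a zonotope $\mathcal Z=\langle c,G\rangle_Z$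 is $C\mathcal Z\oplus[-\Delta v,\Delta v]$ with $v=|c|+\sum_j|G_{(\cdot,j)}|$. Then $\mathcal R^{p,\Delta}(\Psi)=\bigoplus_{i=0}^{\eta}\frac{r^{i+1}}{(i+1)!}A^i\Psi\oplus r[-W,W]\Psi$. $\mathrm{abstrErr}(\mathcal R,\overline\Psi)$ is computed as follows. Let $\mathcal Z=\mathrm{zono}(\mathcal R)$ and $\overline\Psi=\langle c,G\rangle_Z$; let $\mathrm{hull}\langle b,H\rangle_Z=\langle\frac b2,[\frac b2\ \frac H2\ \frac H2]\rangle_Z$, an enclosure of the convex hull with the origin; let $\kappa_i=i^{-i/(i-1)}-i^{-1/(i-1)}$. The set of differences of the states over a step is $$\mathcal R^\Delta=\mathrm{hull}\big((e^{Ar}-I)\mathcal Z\oplus\Gamma(r)c\big)\oplus F\mathcal Z\oplus F'c\oplus\mathcal R^{p,\Delta}(\langle0,G\rangle_Z),$$ where $F=\sum_{i=2}^{\eta}[\kappa_i,0]\frac{r^iA^i}{i!}+[-W,W]$ and $F'=\sum_{i=2}^{\eta+1}[\kappa_i,0]\frac{r^iA^{i-1}}{i!}+r[-W,W]$. Put $\mathcal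 R_z^\Delta=\mathcal R^\Delta\times\mathcal U^\Delta$ and $\mathcal Z_z=\mathcal Z\times\mathcal U$. The result is $$B\,\mathcal U^\Delta\oplus\tfrac12\big(\mathcal Z_zD\mathcal R_z^\Delta\oplus\mathcal R_z^\Delta D\mathcal Z_z\oplus\mathrm{sq}(D,\mathcal R_z^\Delta)\big)\oplus\mathcal L.$$ Here $\mathcal Z_1D\mathcal Z_2$ is the zonotope whose center and generators are the values of $(x,y)\mapsto(x^TD_iy)_i$ at all pairs of centers and generators, and $\mathrm{sq}(D,\mathcal R_z^\Delta)$ is enclosed by $\mathrm{zono}$. $\mathcal L$ is the box around the third-order Lagrange remainder of $f$ at $z_s^*$ on $\mathcal R_z=(\mathcal R\times\{u^c\})\oplus\mathcal R_z^\Delta$ given by interval arithmetic: $\mathcal L_{i}=\frac16\sum_{j,k,l}\mathcal E_{ijkl}\,\delta_j\,\delta_k\,\delta_l$, where $[\underline z,\overline z]$ is the interval enclosure of $\mathrm{zono}(\mathcal R_z)$, $\delta=[\underline z,\overline z]-z_s^*$, and $\mathcal E_{ijkl}$ is the range of $\partial_j\partial_k\partial_lf_i$ over the smallest box containing $[\underline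 z,\overline z]$ and $z_s^*$. **Theorem.** Let $\mathcal X_0\subset\mathbb{R}^n$ be a polynomial zonotope with $p$ dependent factors, and suppose that the algorithm $\mathrm{reach}(\mathcal X_0,\mathbf 0,z_s^*)$, with all initial abstraction errors $\Psi_s=\{0\}$, terminates. Then for every $\alpha\in[-1,1]^p$ and every $x_0\in\mathrm{eval}_{\mathcal X_0}(\alpha)$ (the only such point is $x_0=\mathrm{eval}_{\mathcal X_0}(\alpha)$ if $\mathcal X_0$ has no independent generators), $$\mathcal R^e_{\{x_0\}}(t_f)\subseteq\mathrm{eval}_{\mathrm{reach}(\mathcal X_0,\mathbf 0,z_s^*)}(\alpha).$$ -/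

import Mathlib

open Set MeasureTheory

noncomputable section

namespace ConsPoly

/-! ## Set representations

Matrices of generators are lists of columns, so that concatenation of generator
matrices is `++`. Vectors are functions on a finite index type; the stacked vector
`[x u]` is `Sum.elim x u`. -/

/-- Zonotope given by its center and its generators. -/
structure Zonotope (ι : Type) where
  center : ι → ℝ
  gens : List (ι → ℝ)

/-- Polynomial zonotope: the dependent generators, each with its exponent column, and the
independent generators. The dependent factors are indexed by `π`. -/
structure PolyZonotope (ι π : Type) where
  dep : List ((ι → ℝ) × (π → ℕ))
  indep : List (ι → ℝ)

/-- `{∑ⱼ βⱼ gⱼ | βⱼ ∈ [-1, 1]}` -/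
def genSet {ι : Type} (L : List (ι → ℝ)) : Set (ι → ℝ) :=
  {x | ∃ β : Fin L.length → ℝ, (∀ j, β j ∈ Icc (-1 : ℝ) 1) ∧ x = ∑ j, β j • L.get j}

/-- `∏ₖ αₖ ^ eₖ` -/
def mono {π : Type} [Fintype π] (α : π → ℝ) (e : π → ℕ) : ℝ := ∏ k, α k ^ e k

/-- Sum of the absolute values of the generators in the list, entry by entry. -/
def absSum {ι : Type} (L : List (ι → ℝ)) : ι → ℝ := (L.map fun g i => |g i|).sum

namespace Zonotope

variable {ι κ : Type}

/-- The set of points of a zonotope. -/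
def toSet (Z : Zonotope ι) : Set (ι → ℝ) := {x | ∃ y ∈ genSet Z.gens, x = Z.center + y}

/-- Minkowski sum. -/
def add (Z₁ Z₂ : Zonotope ι) : Zonotope ι := ⟨Z₁.center + Z₂.center, Z₁.gens ++ Z₂.gens⟩

/-- Translation by a vector. -/
def translate (Z : Zonotope ι) (v : ι → ℝ) : Zonotope ι := ⟨Z.center + v, Z.gens⟩

/-- Multiplication by a scalar. -/
def smul (a : ℝ) (Z : Zonotope ι) : Zonotope ι := ⟨a • Z.center, Z.gens.map fun g => a • g⟩

/-- Multiplication by a matrix. -/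
def mulMat [Fintype ι] (M : Matrix κ ι ℝ) (Z : Zonotope ι) : Zonotope κ :=
  ⟨M.mulVec Z.center, Z.gens.map fun g => M.mulVec g⟩

/-- Cartesian product. -/
def prod (Z₁ : Zonotope ι) (Z₂ : Zonotope κ) : Zonotope (ι ⊕ κ) :=
  ⟨Sum.elim Z₁.center Z₂.center,
    (Z₁.gens.map fun g => Sum.elim g (0 : κ → ℝ)) ++ (Z₂.gens.map fun g => Sum.elim (0 : ι → ℝ) g)⟩

/-- The zonotope with its center moved to the origin. -/
def centered (Z : Zonotope ι) : Zonotope ι := ⟨0, Z.gens⟩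

/-- Smallest axis-aligned box around the zonotope: lower corner. -/
def lower (Z : Zonotope ι) : ι → ℝ := Z.center - absSum Z.gens

/-- Smallest axis-aligned box around the zonotope: upper corner. -/
def upper (Z : Zonotope ι) : ι → ℝ := Z.center + absSum Z.gens

/-- Entrywise bound `|c| + ∑ |gⱼ|` of the absolute values of the points of the zonotope. -/
def absBound (Z : Zonotope ι) : ι → ℝ := fun i => |Z.center i| + absSum Z.gens i

/-- Zonotope that encloses the convex hull of the origin and the zonotope. -/
def hullOrigin (Z : Zonotope ι) : Zonotope ι :=
  ⟨(1 / 2 : ℝ) • Z.center,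
    (1 / 2 : ℝ) • Z.center ::
      ((Z.gens.map fun g => (1 / 2 : ℝ) • g) ++ (Z.gens.map fun g => (1 / 2 : ℝ) • g))⟩

/-- The axis-aligned box `[l, u]` as a zonotope. -/
def box {n : ℕ} (l u : Fin n → ℝ) : Zonotope (Fin n) :=
  ⟨(1 / 2 : ℝ) • (l + u), List.ofFn fun i => Pi.single i ((u i - l i) / 2)⟩

/-- Product of the interval matrix `[C - Δ, C + Δ]` with a zonotope. -/
def mulIntervalMat {n : ℕ} (C Δ : Matrix (Fin n) (Fin n) ℝ) (Z : Zonotope (Fin n)) :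
    Zonotope (Fin n) :=
  (Z.mulMat C).add (box (-(Δ.mulVec Z.absBound)) (Δ.mulVec Z.absBound))

end Zonotope

/-- The vector with entries `xᵀ Dᵢ y`. -/
def quadForm {ι κ : Type} [Fintype ι] (D : κ → Matrix ι ι ℝ) (x y : ι → ℝ) : κ → ℝ :=
  fun i => x ⬝ᵥ (D i).mulVec y

/-- Zonotope enclosing `{(xᵀ Dᵢ y)ᵢ | x ∈ Z₁, y ∈ Z₂}`: every product of a center or generator of
`Z₁` and a generator of `Z₂`, or of a generator of `Z₁` and the center of `Z₂`, is a generator. -/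
def Zonotope.bilin {ι κ : Type} [Fintype ι] (D : κ → Matrix ι ι ℝ) (Z₁ Z₂ : Zonotope ι) :
    Zonotope κ :=
  ⟨quadForm D Z₁.center Z₂.center,
    (Z₂.gens.map fun g => quadForm D Z₁.center g) ++
    (Z₁.gens.map fun g => quadForm D g Z₂.center) ++
    (Z₁.gens.flatMap fun g => Z₂.gens.map fun g' => quadForm D g g')⟩

namespace PolyZonotope

variable {ι κ π : Type}

/-- The dependent part `f_{G,E}(α)`. -/
def depPart [Fintype π] (P : PolyZonotope ι π) (α : π → ℝ) : ι → ℝ :=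
  (P.dep.map fun c => mono α c.2 • c.1).sum

/-- Evaluation function: the zonotope `⟨f_{G,E}(α), G_I⟩` obtained by fixing the dependent
factors. -/
def eval [Fintype π] (P : PolyZonotope ι π) (α : π → ℝ) : Set (ι → ℝ) :=
  Zonotope.toSet ⟨P.depPart α, P.indep⟩

/-- The set of points of a polynomial zonotope; the factors range over the unit box. -/
def toSet [Fintype π] (P : PolyZonotope ι π) : Set (ι → ℝ) :=
  ⋃ α ∈ Icc (-1 : π → ℝ) 1, P.eval α

/-- The set `{0}`. -/
def origin : PolyZonotope ι π := ⟨[], []⟩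

/-- A zonotope as a polynomial zonotope: the center is the coefficient of the monomial `1`. -/
def ofZonotope (Z : Zonotope ι) : PolyZonotope ι π := ⟨[(Z.center, 0)], Z.gens⟩

/-- Translation by a vector. -/
def translate (P : PolyZonotope ι π) (v : ι → ℝ) : PolyZonotope ι π :=
  ⟨(v, 0) :: P.dep, P.indep⟩

/-- Minkowski sum with a zonotope, whose factors are new independent factors. -/
def addZonotope (P : PolyZonotope ι π) (Z : Zonotope ι) : PolyZonotope ι π :=
  ⟨(Z.center, 0) :: P.dep, P.indep ++ Z.gens⟩

/-- Exact addition: both summands share the dependent factors. -/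
def exactAdd (P Q : PolyZonotope ι π) : PolyZonotope ι π := ⟨P.dep ++ Q.dep, P.indep ++ Q.indep⟩

/-- Multiplication by a scalar. -/
def smul (a : ℝ) (P : PolyZonotope ι π) : PolyZonotope ι π :=
  ⟨P.dep.map fun c => (a • c.1, c.2), P.indep.map fun g => a • g⟩

/-- Multiplication by a matrix. -/
def mulMat [Fintype ι] (M : Matrix κ ι ℝ) (P : PolyZonotope ι π) : PolyZonotope κ π :=
  ⟨P.dep.map fun c => (M.mulVec c.1, c.2), P.indep.map fun g => M.mulVec g⟩

/-- Cartesian product with a zonotope, whose factors are new independent factors. -/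
def prodZonotope (P : PolyZonotope ι π) (Z : Zonotope κ) : PolyZonotope (ι ⊕ κ) π :=
  ⟨(Sum.elim (0 : ι → ℝ) Z.center, 0) :: P.dep.map fun c => (Sum.elim c.1 0, c.2),
    (P.indep.map fun g => Sum.elim g (0 : κ → ℝ)) ++ (Z.gens.map fun g => Sum.elim (0 : ι → ℝ) g)⟩

/-- Enclosing zonotope. A monomial is the constant 1 if all exponents vanish, ranges over
`[0, 1]` if all exponents are even and not all of them vanish, and over `[-1, 1]` otherwise. -/
def zono [Fintype π] (P : PolyZonotope ι π) : Zonotope ι :=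
  let const := P.dep.filter fun c => decide (∀ k, c.2 k = 0)
  let even := P.dep.filter fun c => decide ((∀ k, Even (c.2 k)) ∧ ¬ ∀ k, c.2 k = 0)
  let rest := P.dep.filter fun c => decide (¬ ∀ k, Even (c.2 k))
  ⟨(const.map Prod.fst).sum + (1 / 2 : ℝ) • (even.map Prod.fst).sum,
    (even.map fun c => (1 / 2 : ℝ) • c.1) ++ rest.map Prod.fst ++ P.indep⟩

/-- The independent factors are turned into additional dependent factors. -/
def allDep (P : PolyZonotope ι π) : PolyZonotope ι (π ⊕ Fin P.indep.length) :=
  ⟨(P.dep.map fun c => (c.1, Sum.elim c.2 (0 : Fin P.indep.length → ℕ))) ++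
    List.ofFn fun j => (P.indep.get j, Sum.elim (0 : π → ℕ) (Pi.single j 1)), []⟩

/-- Quadratic map of a polynomial zonotope without independent generators. -/
def sqDep [Fintype ι] (D : κ → Matrix ι ι ℝ) (P : PolyZonotope ι π) : PolyZonotope κ π :=
  ⟨P.dep.flatMap fun c => P.dep.map fun c' => (quadForm D c.1 c'.1, c.2 + c'.2), []⟩

/-- Quadratic map. The independent factors are first turned into dependent ones; afterwards the
terms in which these additional factors occur are enclosed by a zonotope. -/
def sq [Fintype ι] [Fintype π] (D : κ → Matrix ι ι ℝ) (P : PolyZonotope ι π) :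
    PolyZonotope κ π :=
  let S := P.allDep.sqDep D
  let old := S.dep.filter fun c => decide (∀ j, c.2 (Sum.inr j) = 0)
  let new := S.dep.filter fun c => decide (¬ ∀ j, c.2 (Sum.inr j) = 0)
  addZonotope ⟨old.map fun c => (c.1, fun k => c.2 (Sum.inl k)), []⟩ (zono ⟨new, []⟩)

/-- Euclidean length of a (dependent or independent) generator. -/
def genLength [Fintype ι] (x : (ι → ℝ) × (π → ℕ) ⊕ (ι → ℝ)) : ℝ :=
  Real.sqrt (∑ i, (Sum.elim Prod.fst id x : ι → ℝ) i ^ 2)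

/-- Order reduction to the desired order `ρ`: the shortest generators are enclosed by an
axis-aligned box, all others are kept. -/
def reduce {n : ℕ} [Fintype π] (P : PolyZonotope (Fin n) π) (ρ : ℝ) : PolyZonotope (Fin n) π :=
  let sorted := ((P.dep.map Sum.inl ++ P.indep.map Sum.inr :
    List ((Fin n → ℝ) × (π → ℕ) ⊕ (Fin n → ℝ)))).insertionSort
      fun x y => genLength x ≤ genLength y
  let a : ℕ := min (P.dep.length + P.indep.length)
    ⌈(P.dep.length + P.indep.length : ℝ) - n * (ρ - 1) + 1⌉₊
  let ofList : List ((Fin n → ℝ) × (π → ℕ) ⊕ (Fin n → ℝ)) → PolyZonotope (Fin n) π :=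
    fun L => ⟨L.filterMap Sum.getLeft?, L.filterMap Sum.getRight?⟩
  let Z := (ofList (sorted.take a)).zono
  (ofList (sorted.drop a)).addZonotope (Zonotope.box Z.lower Z.upper)

/-- The enclosing zonotope, enlarged about its center by the factor `lam`. -/
def enlarge [Fintype π] (P : PolyZonotope ι π) (lam : ℝ) : Zonotope ι :=
  ⟨P.zono.center, P.zono.gens.map fun g => lam • g⟩

end PolyZonotope

/-! ## Taylor expansion of the dynamics -/

/-- First partial derivative `∂fᵢ/∂zⱼ`. -/
def partial1 {n : ℕ} {ζ : Type} [Fintype ζ] [DecidableEq ζ] (f : (ζ → ℝ) → Fin n → ℝ)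
    (z : ζ → ℝ) (i : Fin n) (j : ζ) : ℝ :=
  fderiv ℝ f z (Pi.single j 1) i

/-- Second partial derivatives, the `i`-th matrix being the Hessian of `fᵢ`. -/
def partial2 {n : ℕ} {ζ : Type} [Fintype ζ] [DecidableEq ζ] (f : (ζ → ℝ) → Fin n → ℝ)
    (z : ζ → ℝ) (i : Fin n) : Matrix ζ ζ ℝ :=
  Matrix.of fun j k => iteratedFDeriv ℝ 2 f z ![Pi.single j 1, Pi.single k 1] i

/-- Third partial derivatives. -/
def partial3 {n : ℕ} {ζ : Type} [Fintype ζ] [DecidableEq ζ] (f : (ζ → ℝ) → Fin n → ℝ)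
    (z : ζ → ℝ) (i : Fin n) (j k l : ζ) : ℝ :=
  iteratedFDeriv ℝ 3 f z ![Pi.single j 1, Pi.single k 1, Pi.single l 1] i

/-- Coefficients of the second-order Taylor polynomial of `f`, sorted by powers of `z = [x u]`:
`w + A x + B u + ½ zᵀ D z`, and the third partial derivatives `E` as functions of the point. -/
structure TaylorCoeffs (n m : ℕ) where
  w : Fin n → ℝ
  A : Matrix (Fin n) (Fin n) ℝ
  B : Matrix (Fin n) (Fin m) ℝ
  D : Fin n → Matrix (Fin n ⊕ Fin m) (Fin n ⊕ Fin m) ℝ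
  E : (Fin n ⊕ Fin m → ℝ) → Fin n → Fin n ⊕ Fin m → Fin n ⊕ Fin m → Fin n ⊕ Fin m → ℝ

/-- Taylor coefficients at the expansion point `zs`. -/
def taylor {n m : ℕ} (f : (Fin n ⊕ Fin m → ℝ) → Fin n → ℝ) (zs : Fin n ⊕ Fin m → ℝ) :
    TaylorCoeffs n m where
  w := fun i => f zs i - ∑ j, partial1 f zs i j * zs j
    + (1 / 2) * quadForm (partial2 f zs) zs zs i
  A := Matrix.of fun i j =>
    partial1 f zs i (Sum.inl j) - (partial2 f zs i).mulVec zs (Sum.inl j)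
  B := Matrix.of fun i j =>
    partial1 f zs i (Sum.inr j) - (partial2 f zs i).mulVec zs (Sum.inr j)
  D := partial2 f zs
  E := partial3 f

/-! ## Interval arithmetic: an interval is the pair of its bounds, sums are entrywise -/

/-- Product of two intervals. -/
def intervalMul (a b : ℝ × ℝ) : ℝ × ℝ :=
  (min (min (a.1 * b.1) (a.1 * b.2)) (min (a.2 * b.1) (a.2 * b.2)),
    max (max (a.1 * b.1) (a.1 * b.2)) (max (a.2 * b.1) (a.2 * b.2)))

/-- Range of a function on a set, as an interval. -/
def rangeOn {ζ : Type} (g : (ζ → ℝ) → ℝ) (X : Set (ζ → ℝ)) : ℝ × ℝ := (sInf (g '' X), sSup (g '' X))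

/-- Lagrange remainder
`{(1/3!) ∑ⱼₖₗ Eᵢⱼₖₗ(ξ) (z - zs)ⱼ (z - zs)ₖ (z - zs)ₗ | ξ = zs + θ (z - zs), θ ∈ [0, 1], z ∈ R}`,
enclosed by a box with interval arithmetic. -/
def lagrangeRemainder {n : ℕ} {ζ π : Type} [Fintype ζ] [Fintype π] (R : PolyZonotope ζ π)
    (E : (ζ → ℝ) → Fin n → ζ → ζ → ζ → ℝ) (zs : ζ → ℝ) : Zonotope (Fin n) :=
  let lo := R.zono.lower
  let hi := R.zono.upper
  let X : Set (ζ → ℝ) := Icc (lo ⊓ zs) (hi ⊔ zs)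
  let δ : ζ → ℝ × ℝ := fun j => (lo j - zs j, hi j - zs j)
  let L : Fin n → ℝ × ℝ := fun i => (1 / 6 : ℝ) • ∑ j, ∑ k, ∑ l,
    intervalMul (rangeOn (fun ξ => E ξ i j k l) X)
      (intervalMul (δ j) (intervalMul (δ k) (δ l)))
  Zonotope.box (fun i => (L i).1) (fun i => (L i).2)

/-! ## Solutions of linear systems over one time step -/

/-- Entrywise absolute value. -/
def matAbs {n : ℕ} (A : Matrix (Fin n) (Fin n) ℝ) : Matrix (Fin n) (Fin n) ℝ := A.map fun x => |x|

/-- Matrix exponential `e^{At}`. -/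
def expMat {n : ℕ} (A : Matrix (Fin n) (Fin n) ℝ) (t : ℝ) : Matrix (Fin n) (Fin n) ℝ :=
  NormedSpace.exp (t • A)

/-- `Γ(r) = ∫₀ʳ e^{A(r-t)} dt` -/
def gammaMat {n : ℕ} (A : Matrix (Fin n) (Fin n) ℝ) (r : ℝ) : Matrix (Fin n) (Fin n) ℝ :=
  Matrix.of fun i j => ∫ t in (0 : ℝ)..r, expMat A (r - t) i j

/-- Entrywise bound of the remainder of the exponential series of `A r` after the power `η`. -/
def expRem {n : ℕ} (A : Matrix (Fin n) (Fin n) ℝ) (r : ℝ) (η : ℕ) : Matrix (Fin n) (Fin n) ℝ :=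
  expMat (matAbs A) r - ∑ i ∈ Finset.range (η + 1), (r ^ i / (i.factorial : ℝ)) • matAbs A ^ i

/-- Enclosure of `{∫₀ʳ e^{A(r-t)} ψ(t) dt | ψ(t) ∈ Ψ}`:
`⨁_{i ≤ η} (Aⁱ rⁱ⁺¹ / (i+1)!) Ψ ⊕ r [-W, W] Ψ` with the remainder bound `W`. -/
def inputSolution {n : ℕ} (A : Matrix (Fin n) (Fin n) ℝ) (η : ℕ) (Ψ : Zonotope (Fin n)) (r : ℝ) :
    Zonotope (Fin n) :=
  ((List.range (η + 1)).map fun i =>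
      Ψ.mulMat ((r ^ (i + 1) / ((i + 1).factorial : ℝ)) • A ^ i)).foldr Zonotope.add
    (Ψ.mulIntervalMat 0 (r • expRem A r η))

/-- Minimum of `sⁱ - s` over `s ∈ [0, 1]`, for `i ≥ 2`. -/
def curvature (i : ℕ) : ℝ :=
  (i : ℝ) ^ (-(i : ℝ) / ((i : ℝ) - 1)) - (i : ℝ) ^ (-1 / ((i : ℝ) - 1))

/-- Enclosure of `{x(t) - x(0) | t ∈ [0, r]}` over the solutions of `ẋ = A x + ψ(t)` with
`x(0) ∈ R` and `ψ(t) ∈ Ψ`. The interval matrices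
`F = ∑_{2 ≤ i ≤ η} [κᵢ, 0] rⁱ Aⁱ / i! + [-W, W]` and
`F' = ∑_{2 ≤ i ≤ η+1} [κᵢ, 0] rⁱ Aⁱ⁻¹ / i! + r [-W, W]` account for the curvature of the
trajectories, `κᵢ` being `curvature i`. -/
def postDelta {n : ℕ} {π : Type} [Fintype π] (R : PolyZonotope (Fin n) π) (Ψ : Zonotope (Fin n))
    (A : Matrix (Fin n) (Fin n) ℝ) (η : ℕ) (r : ℝ) : Zonotope (Fin n) :=
  let W := expRem A r η
  let FC := ∑ i ∈ Finset.Icc 2 η, (curvature i * r ^ i / (2 * (i.factorial : ℝ))) • A ^ i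
  let FD := ∑ i ∈ Finset.Icc 2 η,
    (|curvature i| * r ^ i / (2 * (i.factorial : ℝ))) • matAbs (A ^ i) + W
  let FC' := ∑ i ∈ Finset.Icc 2 (η + 1),
    (curvature i * r ^ i / (2 * (i.factorial : ℝ))) • A ^ (i - 1)
  let FD' := ∑ i ∈ Finset.Icc 2 (η + 1),
    (|curvature i| * r ^ i / (2 * (i.factorial : ℝ))) • matAbs (A ^ (i - 1)) + r • W
  let hom := ((R.zono.mulMat (expMat A r - 1)).translate
    ((gammaMat A r).mulVec Ψ.center)).hullOrigin
  ((hom.add (R.zono.mulIntervalMat FC FD)).add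
    (Zonotope.mulIntervalMat FC' FD' ⟨Ψ.center, []⟩)).add
      (inputSolution A η Ψ.centered r)

/-- Set of deviations of `B u + ½ zᵀ D z` over a time step from its value at the beginning of the
step: `B UΔ ⊕ ½ (Z D ZΔ ⊕ ZΔ D Z ⊕ ZΔ D ZΔ)`. -/
def varInputs {n m : ℕ} (Z ZΔ : Zonotope (Fin n ⊕ Fin m)) (UΔ : Zonotope (Fin m))
    (B : Matrix (Fin n) (Fin m) ℝ) (D : Fin n → Matrix (Fin n ⊕ Fin m) (Fin n ⊕ Fin m) ℝ) :
    Zonotope (Fin n) :=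
  let sqΔ : Zonotope (Fin n) :=
    ((PolyZonotope.ofZonotope ZΔ : PolyZonotope (Fin n ⊕ Fin m) Empty).sq D).zono
  (UΔ.mulMat B).add
    (Zonotope.smul (1 / 2) (((Zonotope.bilin D Z ZΔ).add (Zonotope.bilin D ZΔ Z)).add sqΔ))

/-! ## The reachability algorithm -/

/-- Data of a reachability problem `ẋ = f(x, u)`, `u ∈ U`, and parameters of the algorithm. -/
structure Problem (n m : ℕ) where
  /-- right-hand side, as a function of `z = [x u]` -/
  f : (Fin n ⊕ Fin m → ℝ) → Fin n → ℝ
  /-- set of input values -/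
  U : Zonotope (Fin m)
  /-- time horizon -/
  tf : ℝ
  /-- time step size -/
  r : ℝ
  /-- enlargement factor -/
  lam : ℝ
  /-- desired zonotope order -/
  rho : ℝ
  /-- number of Taylor terms of the matrix exponential -/
  eta : ℕ

variable {n m : ℕ} {π : Type} [Fintype π]

/-- Set of abstraction errors for the reachable set `R`, the applied abstraction errors `Ψbar` and
the expansion point `zs`. -/
def abstrErr (P : Problem n m) (zs : Fin n ⊕ Fin m → ℝ) (R : PolyZonotope (Fin n) π)
    (Ψbar : Zonotope (Fin n)) : Zonotope (Fin n) :=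
  let T := taylor P.f zs
  let UΔ := P.U.centered
  let Zz := R.zono.prod P.U
  let RzΔ := (postDelta R Ψbar T.A P.eta P.r).prod UΔ
  let VΔ := varInputs Zz RzΔ UΔ T.B T.D
  let Rτ := (R.prodZonotope ⟨P.U.center, []⟩).addZonotope RzΔ
  VΔ.add (lagrangeRemainder Rτ T.E zs)

/-- `V = w ⊕ B u_c ⊕ ½ sq(D, R × U)` -/
def staticInputs (P : Problem n m) (zs : Fin n ⊕ Fin m → ℝ) (R : PolyZonotope (Fin n) π) :
    PolyZonotope (Fin n) π :=
  let T := taylor P.f zs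
  (((R.prodZonotope P.U).sq T.D).smul (1 / 2)).translate (T.w + T.B.mulVec P.U.center)

/-- The set of abstraction errors after `k` passes of the repeat-until loop, started from `Ψ₀`. -/
def errIter (P : Problem n m) (zs : Fin n ⊕ Fin m → ℝ) (R Ψ₀ : PolyZonotope (Fin n) π) :
    ℕ → PolyZonotope (Fin n) π
  | 0 => Ψ₀
  | k + 1 => (staticInputs P zs R).addZonotope
      (abstrErr P zs R ((errIter P zs R Ψ₀ k).enlarge P.lam))

/-- The stopping condition of the repeat-until loop holds at the end of pass `k + 1`. -/
def LoopStops (P : Problem n m) (zs : Fin n ⊕ Fin m → ℝ) (R Ψ₀ : PolyZonotope (Fin n) π)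
    (k : ℕ) : Prop :=
  (errIter P zs R Ψ₀ (k + 1)).toSet ⊆ ((errIter P zs R Ψ₀ k).enlarge P.lam).toSet

/-- The reachable set after one time step, computed from the abstraction errors `ΨΔ`. -/
def propagate (P : Problem n m) (zs : Fin n ⊕ Fin m → ℝ) (R : PolyZonotope (Fin n) π)
    (ΨΔ : Zonotope (Fin n)) : PolyZonotope (Fin n) π :=
  let A := (taylor P.f zs).A
  let Rhat := (PolyZonotope.exactAdd (R.mulMat (expMat A P.r))
    ((staticInputs P zs R).mulMat (gammaMat A P.r))).addZonotope
      (inputSolution A P.eta ΨΔ P.r)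
  Rhat.reduce P.rho

/-- `Post P zs Ψ₀ R R'`: the body of the while loop, started from `R` with initial abstraction
errors `Ψ₀`, terminates with result `R'`. The repeat-until loop ends with its first pass that meets
the stopping condition. -/
def Post (P : Problem n m) (zs : Fin n ⊕ Fin m → ℝ) (Ψ₀ R R' : PolyZonotope (Fin n) π) : Prop :=
  ∃ k, IsLeast {k | LoopStops P zs R Ψ₀ k} k ∧
    R' = propagate P zs R (abstrErr P zs R ((errIter P zs R Ψ₀ k).enlarge P.lam))

/-- `Steps P X₀ Ψ₀ zs s R`: the algorithm reaches time `t_s = s r` with `R(t_s) = R`. -/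
inductive Steps (P : Problem n m) (X₀ : PolyZonotope (Fin n) π) (Ψ₀ : ℕ → PolyZonotope (Fin n) π)
    (zs : ℕ → Fin n ⊕ Fin m → ℝ) : ℕ → PolyZonotope (Fin n) π → Prop
  | init : Steps P X₀ Ψ₀ zs 0 X₀
  | step {s : ℕ} {R R' : PolyZonotope (Fin n) π} : Steps P X₀ Ψ₀ zs s R → s * P.r < P.tf →
      Post P (zs s) (Ψ₀ s) R R' → Steps P X₀ Ψ₀ zs (s + 1) R'

/-- `Reach P X₀ Ψ₀ zs R`: the algorithm `reach(X₀, Ψ₀, zs)` terminates with final reachable set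
`R`. -/
def Reach (P : Problem n m) (X₀ : PolyZonotope (Fin n) π) (Ψ₀ : ℕ → PolyZonotope (Fin n) π)
    (zs : ℕ → Fin n ⊕ Fin m → ℝ) (R : PolyZonotope (Fin n) π) : Prop :=
  ∃ s : ℕ, Steps P X₀ Ψ₀ zs s R ∧ ¬ s * P.r < P.tf

/-- `x` solves `ẋ = f(x, u)`, `x(0) = x₀`, on `[0, t]` (in integrated form, since `u` is merely
measurable). -/
def IsSolution (f : (Fin n ⊕ Fin m → ℝ) → Fin n → ℝ) (x₀ : Fin n → ℝ) (u : ℝ → Fin m → ℝ) (t : ℝ)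
    (x : ℝ → Fin n → ℝ) : Prop :=
  ContinuousOn x (Icc 0 t) ∧
    ∀ τ ∈ Icc 0 t, x τ = x₀ + ∫ σ in (0 : ℝ)..τ, f (Sum.elim (x σ) (u σ))

/-- Exact reachable set at time `t` for the initial set `X₀` and the set `U` of input values. -/
def exactReach (f : (Fin n ⊕ Fin m → ℝ) → Fin n → ℝ) (U : Set (Fin m → ℝ)) (X₀ : Set (Fin n → ℝ))
    (t : ℝ) : Set (Fin n → ℝ) :=
  {y | ∃ x₀ ∈ X₀, ∃ (u : ℝ → Fin m → ℝ) (x : ℝ → Fin n → ℝ), Measurable u ∧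
    (∀ τ ∈ Icc 0 t, u τ ∈ U) ∧ IsSolution f x₀ u t x ∧ y = x t}

end ConsPoly

end

/-! Fix `α` and a starting point `x₀`. Every set operation of the algorithm is sound with `α` held
fixed: dependent terms are evaluated at the same `α`, and whatever is not tracked exactly is
enclosed by independent generators (`PolyZonotope.eval_subset_zono`, `PolyZonotope.quadForm_mem_sq`,
`PolyZonotope.eval_subset_reduce`). It remains to show that one time step propagates solutions
(`Post.solution_mem`) and to induct over the steps (`Steps.solution_mem`).

Within a step write `f(x, u) = A x + v₀ + ψΔ`. Here `v₀` is the quadratic Taylor part at `x₀` and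
the center of the input set; it lies in the static inputs for this `α`. The rest `ψΔ` collects input
variation, quadratic variation and Lagrange remainder. It lies in the set of abstraction errors as
soon as `x - x₀` lies in the set of state differences (`sub_staticPoint_mem_abstrErr`). That set is
in turn computed from an assumed enclosure `Ψbar` of `f - A x`, so the argument looks circular.

The stopping condition of the loop closes the circle. Let `K` be `x₀` plus the set of state
differences for `Ψbar`. On `K`, `f - A x` lies in static inputs plus abstraction errors, hence in
`Ψbar`; by `mem_postDelta` the Picard map of the variation-of-constants formula sends curves in `K`
to curves in `K`. Picard iteration started at the constant `x₀` converges to the solution, and `K`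
is closed, so the solution stays in `K` (`mem_of_picard_invariant`). Thus the abstraction errors are
valid along the true trajectory, and `eq_expMat_mulVec_add_convExp` with the input split into `v₀`
and `ψΔ` gives the propagated set.

The linear enclosures rest on two facts: a weighted integral of points of a closed convex set is the
total weight times a point of the set (`exists_integral_smul_eq`), and the deviation of `e^{At}`
from linear interpolation has coefficients `(sⁱ - s) rⁱ / i!` with `sⁱ - s` in `[κᵢ, 0]`
(`curvature_le`). -/

namespace ConsPoly

/-! ## Sets of combinations of generators -/

section GenSet

variable {ι κ : Type}

lemma genSet_nil : genSet ([] : List (ι → ℝ)) = {0} := by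
  ext x
  constructor
  · rintro ⟨β, -, h⟩
    simpa using h
  · intro h
    exact ⟨fun _ => 0, fun j => j.elim0, by simpa using h⟩

/-- Turns the sum indexed by `Fin` into a recursion on the list, on which most later membership
facts are proved by induction. -/
lemma mem_genSet_cons {g : ι → ℝ} {L : List (ι → ℝ)} {x : ι → ℝ} :
    x ∈ genSet (g :: L) ↔ ∃ b ∈ Icc (-1 : ℝ) 1, ∃ y ∈ genSet L, x = b • g + y := by
  constructor
  · rintro ⟨β, hβ, h⟩
    refine ⟨β ⟨0, by simp⟩, hβ _, ∑ j : Fin L.length, β j.succ • L.get j,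
      ⟨fun j => β j.succ, fun j => hβ _, rfl⟩, ?_⟩
    rw [h]
    exact Fin.sum_univ_succ (n := L.length) (fun j => β j • (g :: L).get j)
  · rintro ⟨b, hb, y, ⟨β, hβ, rfl⟩, rfl⟩
    refine ⟨(Fin.cons b β : Fin (L.length + 1) → ℝ), fun j => ?_, ?_⟩
    · refine Fin.cases ?_ (fun j => ?_) (j : Fin (L.length + 1))
      · simpa using hb
      · simpa using hβ j
    · exact (Fin.sum_univ_succ (n := L.length)
        (fun j => (Fin.cons b β : Fin (L.length + 1) → ℝ) j • (g :: L).get j)).symm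

lemma mem_genSet_append {L M : List (ι → ℝ)} {x : ι → ℝ} :
    x ∈ genSet (L ++ M) ↔ ∃ y ∈ genSet L, ∃ z ∈ genSet M, x = y + z := by
  induction L generalizing x with
  | nil => simp [genSet_nil]
  | cons g L ih =>
    simp only [List.cons_append, mem_genSet_cons, ih]
    constructor
    · rintro ⟨b, hb, _, ⟨y, hy, z, hz, rfl⟩, rfl⟩
      exact ⟨_, ⟨b, hb, y, hy, rfl⟩, z, hz, by rw [add_assoc]⟩
    · rintro ⟨_, ⟨b, hb, y, hy, rfl⟩, z, hz, rfl⟩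
      exact ⟨b, hb, _, ⟨y, hy, z, hz, rfl⟩, by rw [add_assoc]⟩

lemma add_mem_genSet_append {L M : List (ι → ℝ)} {y z : ι → ℝ} (hy : y ∈ genSet L)
    (hz : z ∈ genSet M) : y + z ∈ genSet (L ++ M) :=
  mem_genSet_append.2 ⟨y, hy, z, hz, rfl⟩

lemma genSet_perm {L M : List (ι → ℝ)} (h : L.Perm M) : genSet L = genSet M := by
  induction h with
  | nil => rfl
  | cons x _ ih => ext y; simp only [mem_genSet_cons, ih]
  | swap x y l =>
    ext z
    simp only [mem_genSet_cons]
    constructor <;>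
    · rintro ⟨b, hb, _, ⟨c, hc, w, hw, rfl⟩, rfl⟩
      exact ⟨c, hc, _, ⟨b, hb, w, hw, rfl⟩, by rw [add_left_comm]⟩
  | trans _ _ h₁ h₂ => exact h₁.trans h₂

lemma genSet_map (φ : (ι → ℝ) →ₗ[ℝ] (κ → ℝ)) (L : List (ι → ℝ)) {x : ι → ℝ}
    (hx : x ∈ genSet L) : φ x ∈ genSet (L.map fun g => φ g) := by
  induction L generalizing x with
  | nil => simpa [genSet_nil] using congrArg φ (show x = 0 by simpa [genSet_nil] using hx)
  | cons g L ih =>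
    obtain ⟨b, hb, y, hy, rfl⟩ := mem_genSet_cons.1 hx
    exact mem_genSet_cons.2 ⟨b, hb, φ y, ih hy, by simp⟩

lemma smul_mem_genSet {L : List (ι → ℝ)} {x : ι → ℝ} (hx : x ∈ genSet L) {a : ℝ}
    (ha : a ∈ Icc (-1 : ℝ) 1) : a • x ∈ genSet L := by
  obtain ⟨β, hβ, rfl⟩ := hx
  refine ⟨fun j => a * β j, fun j => ?_, by simp [Finset.smul_sum, mul_smul]⟩
  refine abs_le.1 ?_
  rw [abs_mul]
  exact mul_le_one₀ (abs_le.2 ha) (abs_nonneg _) (abs_le.2 (hβ j))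

lemma zero_mem_genSet (L : List (ι → ℝ)) : (0 : ι → ℝ) ∈ genSet L :=
  ⟨fun _ => 0, fun _ => by simp, by simp⟩

lemma genSet_eq_image (L : List (ι → ℝ)) :
    genSet L = (fun β : Fin L.length → ℝ => ∑ j, β j • L.get j) ''
      (univ.pi fun _ => Icc (-1 : ℝ) 1) := by
  ext x
  simp only [genSet, mem_ofPred_eq, mem_image, mem_pi, mem_univ, true_implies]
  exact ⟨fun ⟨β, h, e⟩ => ⟨β, h, e.symm⟩, fun ⟨β, h, e⟩ => ⟨β, h, e.symm⟩⟩

lemma isCompact_genSet (L : List (ι → ℝ)) : IsCompact (genSet L) := by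
  rw [genSet_eq_image]
  exact (isCompact_univ_pi fun _ => isCompact_Icc).image (by fun_prop)

lemma convex_genSet (L : List (ι → ℝ)) : Convex ℝ (genSet L) := by
  rw [genSet_eq_image]
  refine (convex_pi fun _ _ => convex_Icc (-1 : ℝ) 1).is_linear_image ⟨fun x y => ?_, fun a x => ?_⟩
  · simp [add_smul, Finset.sum_add_distrib]
  · simp [mul_smul, Finset.smul_sum]

lemma absSum_nil : absSum ([] : List (ι → ℝ)) = 0 := rfl

lemma absSum_cons (g : ι → ℝ) (L : List (ι → ℝ)) :
    absSum (g :: L) = (fun i => |g i|) + absSum L := by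
  simp [absSum]

lemma abs_le_absSum {L : List (ι → ℝ)} {x : ι → ℝ} (hx : x ∈ genSet L) (i : ι) :
    |x i| ≤ absSum L i := by
  induction L generalizing x with
  | nil =>
    have : x = 0 := by simpa [genSet_nil] using hx
    simp [this, absSum_nil]
  | cons g L ih =>
    obtain ⟨b, hb, y, hy, rfl⟩ := mem_genSet_cons.1 hx
    rw [absSum_cons]
    simp only [Pi.add_apply, Pi.smul_apply, smul_eq_mul]
    refine (abs_add_le _ _).trans (add_le_add ?_ (ih hy))
    rw [abs_mul]
    exact mul_le_of_le_one_left (abs_nonneg _) (abs_le.2 hb)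

lemma sum_mem_genSet_ofFn {k : ℕ} (g : Fin k → ι → ℝ) {β : Fin k → ℝ}
    (hβ : ∀ j, β j ∈ Icc (-1 : ℝ) 1) : ∑ j, β j • g j ∈ genSet (List.ofFn g) := by
  induction k with
  | zero => simpa using zero_mem_genSet _
  | succ k ih =>
    rw [List.ofFn_succ, Fin.sum_univ_succ]
    exact mem_genSet_cons.2 ⟨_, hβ 0, _, ih (fun j => g j.succ) fun j => hβ j.succ, rfl⟩

end GenSet

/-! ## Operations on zonotopes -/

namespace Zonotope

variable {ι κ : Type}

lemma mem_toSet {Z : Zonotope ι} {x : ι → ℝ} : x ∈ Z.toSet ↔ x - Z.center ∈ genSet Z.gens := by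
  constructor
  · rintro ⟨y, hy, rfl⟩
    simpa using hy
  · intro h
    exact ⟨_, h, by simp⟩

lemma toSet_eq_image (Z : Zonotope ι) : Z.toSet = (fun y => Z.center + y) '' genSet Z.gens := by
  ext x
  exact ⟨fun ⟨y, hy, e⟩ => ⟨y, hy, e.symm⟩, fun ⟨y, hy, e⟩ => ⟨y, hy, e.symm⟩⟩

lemma isCompact_toSet (Z : Zonotope ι) : IsCompact Z.toSet := by
  rw [toSet_eq_image]
  exact (isCompact_genSet _).image (by fun_prop)

lemma isClosed_toSet (Z : Zonotope ι) : IsClosed Z.toSet := Z.isCompact_toSet.isClosed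

lemma convex_toSet (Z : Zonotope ι) : Convex ℝ Z.toSet := by
  rw [toSet_eq_image]
  exact (convex_genSet _).translate _

lemma center_mem (Z : Zonotope ι) : Z.center ∈ Z.toSet :=
  mem_toSet.2 (by simpa using zero_mem_genSet _)

lemma sub_center_mem_centered {Z : Zonotope ι} {x : ι → ℝ} (hx : x ∈ Z.toSet) :
    x - Z.center ∈ Z.centered.toSet :=
  mem_toSet.2 (by simpa [centered] using mem_toSet.1 hx)

lemma zero_mem_centered (Z : Zonotope ι) : (0 : ι → ℝ) ∈ Z.centered.toSet :=
  Z.centered.center_mem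

lemma add_mem_add {Z₁ Z₂ : Zonotope ι} {x y : ι → ℝ} (hx : x ∈ Z₁.toSet) (hy : y ∈ Z₂.toSet) :
    x + y ∈ (Z₁.add Z₂).toSet := by
  rw [mem_toSet] at *
  have := add_mem_genSet_append hx hy
  rwa [show x - Z₁.center + (y - Z₂.center) = x + y - (Z₁.center + Z₂.center) by abel] at this

lemma add_mem_translate {Z : Zonotope ι} {x : ι → ℝ} (hx : x ∈ Z.toSet) (v : ι → ℝ) :
    x + v ∈ (Z.translate v).toSet := by
  rw [mem_toSet] at *
  simpa [translate] using hx

lemma smul_mem_smul {Z : Zonotope ι} {x : ι → ℝ} (hx : x ∈ Z.toSet) (a : ℝ) :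
    a • x ∈ (Z.smul a).toSet := by
  rw [mem_toSet] at *
  have h := genSet_map (a • LinearMap.id) _ hx
  simp only [LinearMap.smul_apply, LinearMap.id_apply, smul_sub] at h
  exact h

lemma mulVec_mem_mulMat [Fintype ι] {Z : Zonotope ι} {x : ι → ℝ} (hx : x ∈ Z.toSet)
    (M : Matrix κ ι ℝ) : M.mulVec x ∈ (Z.mulMat M).toSet := by
  rw [mem_toSet] at *
  simpa [mulMat, Matrix.mulVec_sub] using genSet_map M.mulVecLin _ hx

/-- The embedding `x ↦ [x 0]`. -/
def inlMap (ι κ : Type) : (ι → ℝ) →ₗ[ℝ] (ι ⊕ κ → ℝ) where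
  toFun x := Sum.elim x 0
  map_add' x y := by ext (i | i) <;> simp
  map_smul' a x := by ext (i | i) <;> simp

/-- The embedding `y ↦ [0 y]`. -/
def inrMap (ι κ : Type) : (κ → ℝ) →ₗ[ℝ] (ι ⊕ κ → ℝ) where
  toFun x := Sum.elim 0 x
  map_add' x y := by ext (i | i) <;> simp
  map_smul' a x := by ext (i | i) <;> simp

lemma elim_mem_genSet {L : List (ι → ℝ)} {M : List (κ → ℝ)} {x : ι → ℝ} {y : κ → ℝ}
    (hx : x ∈ genSet L) (hy : y ∈ genSet M) :
    Sum.elim x y ∈ genSet ((L.map fun g => Sum.elim g (0 : κ → ℝ)) ++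
      (M.map fun g => Sum.elim (0 : ι → ℝ) g)) := by
  have h := add_mem_genSet_append (genSet_map (inlMap ι κ) _ hx) (genSet_map (inrMap ι κ) _ hy)
  rwa [show inlMap ι κ x + inrMap ι κ y = Sum.elim x y by
    ext (i | i) <;> simp [inlMap, inrMap]] at h

lemma elim_mem_prod {Z₁ : Zonotope ι} {Z₂ : Zonotope κ} {x : ι → ℝ} {y : κ → ℝ}
    (hx : x ∈ Z₁.toSet) (hy : y ∈ Z₂.toSet) : Sum.elim x y ∈ (Z₁.prod Z₂).toSet := by
  rw [mem_toSet] at *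
  have h := elim_mem_genSet hx hy
  rwa [show Sum.elim (x - Z₁.center) (y - Z₂.center) =
    Sum.elim x y - Sum.elim Z₁.center Z₂.center by ext (i | i) <;> simp] at h

lemma abs_le_absBound {Z : Zonotope ι} {x : ι → ℝ} (hx : x ∈ Z.toSet) (i : ι) :
    |x i| ≤ Z.absBound i := by
  have h := abs_le_absSum (mem_toSet.1 hx) i
  calc |x i| = |Z.center i + (x - Z.center) i| := by simp
    _ ≤ |Z.center i| + |(x - Z.center) i| := abs_add_le _ _
    _ ≤ _ := by unfold absBound; gcongr

lemma lower_le {Z : Zonotope ι} {x : ι → ℝ} (hx : x ∈ Z.toSet) : Z.lower ≤ x := by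
  intro i
  have h := abs_le.1 (abs_le_absSum (mem_toSet.1 hx) i)
  simp only [lower, Pi.sub_apply] at *
  linarith

lemma le_upper {Z : Zonotope ι} {x : ι → ℝ} (hx : x ∈ Z.toSet) : x ≤ Z.upper := by
  intro i
  have h := abs_le.1 (abs_le_absSum (mem_toSet.1 hx) i)
  simp only [upper, Pi.add_apply, Pi.sub_apply] at *
  linarith

lemma mem_box {n : ℕ} {l u x : Fin n → ℝ} (hl : l ≤ x) (hu : x ≤ u) : x ∈ (box l u).toSet := by
  rw [mem_toSet]
  simp only [box]
  -- The factor that places `x i` between the corners. On a degenerate edge the division returns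
  -- `0`, which is harmless because then `x i = l i = u i`.
  set β : Fin n → ℝ := fun i => (2 * x i - l i - u i) / (u i - l i) with hβ
  have key : ∀ i, β i * ((u i - l i) / 2) = x i - (l i + u i) / 2 := by
    intro i
    rcases eq_or_ne (u i - l i) 0 with h | h
    · have h1 := hl i
      have h2 := hu i
      rw [h]
      linarith
    · simp only [hβ]
      field_simp
      ring
  have hmem : ∀ i, β i ∈ Icc (-1 : ℝ) 1 := by
    intro i
    have h1 := hl i
    have h2 := hu i
    refine abs_le.1 ?_
    rw [hβ, abs_div]
    refine div_le_one_of_le₀ ?_ (abs_nonneg _)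
    rw [abs_of_nonneg (by linarith : 0 ≤ u i - l i), abs_le]
    constructor <;> linarith
  convert sum_mem_genSet_ofFn (fun i => (Pi.single i ((u i - l i) / 2) : Fin n → ℝ)) hmem using 1
  ext i
  simp only [Pi.sub_apply, Pi.smul_apply, Pi.add_apply, smul_eq_mul, Finset.sum_apply,
    Pi.single_apply, mul_ite, mul_zero, Finset.sum_ite_eq, Finset.mem_univ, if_true, key]
  ring

lemma toSet_subset_box {n : ℕ} (Z : Zonotope (Fin n)) :
    Z.toSet ⊆ (box Z.lower Z.upper).toSet :=
  fun _ hx => mem_box (lower_le hx) (le_upper hx)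

/-- A scaled point of a zonotope by a factor in `[0, 1]` lies in the hull with the origin. -/
lemma smul_mem_hullOrigin {Z : Zonotope ι} {x : ι → ℝ} (hx : x ∈ Z.toSet) {s : ℝ}
    (hs : s ∈ Icc (0 : ℝ) 1) : s • x ∈ Z.hullOrigin.toSet := by
  rw [mem_toSet] at *
  have hs' : s ∈ Icc (-1 : ℝ) 1 := ⟨by linarith [hs.1], hs.2⟩
  have h := genSet_map ((1 / 2 : ℝ) • LinearMap.id) _ (smul_mem_genSet hx hs')
  -- With center `c`, `s c = c/2 + (2s - 1) c/2`; the scaled generator part is split evenly between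
  -- the two copies of the halved generators.
  refine mem_genSet_cons.2 ⟨2 * s - 1, ⟨by linarith [hs.1], by linarith [hs.2]⟩, _,
    add_mem_genSet_append h h, ?_⟩
  ext i
  simp [hullOrigin]
  ring

/-- Entrywise bound for the product of a matrix with a point of a zonotope. -/
lemma abs_mulVec_le [Fintype ι] {Z : Zonotope ι} {x : ι → ℝ} (hx : x ∈ Z.toSet)
    {M Δ : Matrix κ ι ℝ} (h : ∀ i j, |M i j| ≤ Δ i j) (i : κ) :
    |M.mulVec x i| ≤ Δ.mulVec Z.absBound i := by
  simp only [Matrix.mulVec, dotProduct]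
  refine (Finset.abs_sum_le_sum_abs _ _).trans (Finset.sum_le_sum fun j _ => ?_)
  rw [abs_mul]
  exact mul_le_mul (h i j) (abs_le_absBound hx j) (abs_nonneg _) ((abs_nonneg _).trans (h i j))

/-- The box summand needs only an entrywise bound on `y`. This covers integrals of a varying matrix
applied to a varying vector, which are not a single matrix applied to a single point. -/
lemma mulVec_add_mem_mulIntervalMat {n : ℕ} {C Δ : Matrix (Fin n) (Fin n) ℝ}
    {Z : Zonotope (Fin n)} {x y : Fin n → ℝ} (hx : x ∈ Z.toSet)
    (hy : ∀ i, |y i| ≤ Δ.mulVec Z.absBound i) :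
    C.mulVec x + y ∈ (mulIntervalMat C Δ Z).toSet :=
  add_mem_add (mulVec_mem_mulMat hx C)
    (mem_box (fun i => (abs_le.1 (hy i)).1) (fun i => (abs_le.1 (hy i)).2))

lemma mulVec_mem_mulIntervalMat {n : ℕ} {M C Δ : Matrix (Fin n) (Fin n) ℝ}
    {Z : Zonotope (Fin n)} {x : Fin n → ℝ} (hx : x ∈ Z.toSet)
    (h : ∀ i j, |(M - C) i j| ≤ Δ i j) :
    M.mulVec x ∈ (mulIntervalMat C Δ Z).toSet := by
  have := mulVec_add_mem_mulIntervalMat (C := C) hx (abs_mulVec_le hx h)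
  rwa [← Matrix.add_mulVec, add_sub_cancel] at this

end Zonotope

/-! ## Quadratic forms -/

section QuadForm

variable {ι κ : Type} [Fintype ι] (D : κ → Matrix ι ι ℝ)

lemma quadForm_add_left (x x' y : ι → ℝ) :
    quadForm D (x + x') y = quadForm D x y + quadForm D x' y := by
  ext i; simp [quadForm, add_dotProduct]

lemma quadForm_add_right (x y y' : ι → ℝ) :
    quadForm D x (y + y') = quadForm D x y + quadForm D x y' := by
  ext i; simp [quadForm, Matrix.mulVec_add, dotProduct_add]

lemma quadForm_smul_left (a : ℝ) (x y : ι → ℝ) : quadForm D (a • x) y = a • quadForm D x y := by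
  ext i; simp [quadForm]

lemma quadForm_smul_right (a : ℝ) (x y : ι → ℝ) : quadForm D x (a • y) = a • quadForm D x y := by
  ext i; simp [quadForm, Matrix.mulVec_smul]

lemma quadForm_zero_left (y : ι → ℝ) : quadForm D 0 y = 0 := by
  simpa using quadForm_smul_left D 0 0 y

lemma quadForm_zero_right (x : ι → ℝ) : quadForm D x 0 = 0 := by
  simpa using quadForm_smul_right D 0 x 0

/-- `y ↦ (xᵀ Dᵢ y)ᵢ` as a linear map. -/
def quadFormRight (x : ι → ℝ) : (ι → ℝ) →ₗ[ℝ] (κ → ℝ) where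
  toFun y := quadForm D x y
  map_add' := quadForm_add_right D x
  map_smul' a y := quadForm_smul_right D a x y

/-- `x ↦ (xᵀ Dᵢ y)ᵢ` as a linear map. -/
def quadFormLeft (y : ι → ℝ) : (ι → ℝ) →ₗ[ℝ] (κ → ℝ) where
  toFun x := quadForm D x y
  map_add' x x' := quadForm_add_left D x x' y
  map_smul' a x := quadForm_smul_left D a x y

/-- By bilinearity the factor of each left generator moves to the right argument, where a factor in
`[-1, 1]` does not leave `genSet M`. -/
lemma quadForm_mem_genSet {L M : List (ι → ℝ)} {x y : ι → ℝ} (hx : x ∈ genSet L)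
    (hy : y ∈ genSet M) :
    quadForm D x y ∈ genSet (L.flatMap fun g => M.map fun g' => quadForm D g g') := by
  induction L generalizing x with
  | nil =>
    have : x = 0 := by simpa [genSet_nil] using hx
    simp [this, genSet_nil, quadForm_zero_left]
  | cons g L ih =>
    obtain ⟨b, hb, z, hz, rfl⟩ := mem_genSet_cons.1 hx
    rw [List.flatMap_cons, quadForm_add_left, quadForm_smul_left, ← quadForm_smul_right]
    exact add_mem_genSet_append (genSet_map (quadFormRight D g) _ (smul_mem_genSet hy hb)) (ih hz)

lemma Zonotope.quadForm_mem_bilin {Z₁ Z₂ : Zonotope ι} {x y : ι → ℝ} (hx : x ∈ Z₁.toSet)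
    (hy : y ∈ Z₂.toSet) : quadForm D x y ∈ (Zonotope.bilin D Z₁ Z₂).toSet := by
  obtain ⟨a, ha, rfl⟩ := hx
  obtain ⟨b, hb, rfl⟩ := hy
  refine ⟨_, add_mem_genSet_append (add_mem_genSet_append
    (genSet_map (quadFormRight D Z₁.center) _ hb) (genSet_map (quadFormLeft D Z₂.center) _ ha))
    (quadForm_mem_genSet D ha hb), ?_⟩
  simp only [quadForm_add_left, quadForm_add_right, quadFormRight, quadFormLeft, bilin,
    LinearMap.coe_mk, AddHom.coe_mk]
  abel

end QuadForm

/-! ### Monomials in the dependent factors. -/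

section Mono

variable {π : Type} [Fintype π]

lemma mono_zero (α : π → ℝ) : mono α 0 = 1 := by simp [mono]

lemma mono_add (α : π → ℝ) (e e' : π → ℕ) : mono α (e + e') = mono α e * mono α e' := by
  simp [mono, pow_add, Finset.prod_mul_distrib]

lemma mono_sumElim {ρ : Type} [Fintype ρ] (α : π → ℝ) (β : ρ → ℝ) (e : π ⊕ ρ → ℕ) :
    mono (Sum.elim α β) e = mono α (fun k => e (Sum.inl k)) * mono β (fun k => e (Sum.inr k)) := by
  simp [mono]

lemma mono_single [DecidableEq π] (β : π → ℝ) (j : π) :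
    mono β (Pi.single j 1) = β j := by
  unfold mono
  rw [Finset.prod_eq_single j]
  · simp
  · intro k _ hk
    simp [Pi.single_eq_of_ne hk]
  · simp

lemma mono_mem_Icc {α : π → ℝ} (hα : α ∈ Icc (-1 : π → ℝ) 1) (e : π → ℕ) :
    mono α e ∈ Icc (-1 : ℝ) 1 := by
  refine abs_le.1 ?_
  unfold mono
  rw [Finset.abs_prod]
  refine Finset.prod_le_one (fun _ _ => abs_nonneg _) fun k _ => ?_
  rw [abs_pow]
  exact pow_le_one₀ (abs_nonneg _) (abs_le.2 ⟨hα.1 k, hα.2 k⟩)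

lemma mono_nonneg_of_even {α : π → ℝ} {e : π → ℕ} (he : ∀ k, Even (e k)) : 0 ≤ mono α e :=
  Finset.prod_nonneg fun k _ => (he k).pow_nonneg _

end Mono

/-! ### Soundness of the polynomial zonotope operations for fixed dependent factors. -/

namespace PolyZonotope

variable {ι κ π : Type} [Fintype π]

lemma mem_eval {P : PolyZonotope ι π} {α : π → ℝ} {x : ι → ℝ} :
    x ∈ P.eval α ↔ x - P.depPart α ∈ genSet P.indep := Zonotope.mem_toSet

/-- Needed for order reduction, which sorts the generators by length. -/
lemma eval_perm {P Q : PolyZonotope ι π} (hd : P.dep.Perm Q.dep) (hi : P.indep.Perm Q.indep)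
    (α : π → ℝ) : P.eval α = Q.eval α := by
  ext x
  rw [mem_eval, mem_eval, genSet_perm hi, depPart, depPart, (hd.map _).sum_eq]

/-- With a common `α` the dependent parts simply add, while the independent factors of the summands
remain separate. The forward direction serves to split a polynomial zonotope in order reduction. -/
lemma mem_eval_exactAdd {P Q : PolyZonotope ι π} {α : π → ℝ} {x : ι → ℝ} :
    x ∈ (P.exactAdd Q).eval α ↔ ∃ y ∈ P.eval α, ∃ z ∈ Q.eval α, x = y + z := by
  simp only [mem_eval]
  have hd : (P.exactAdd Q).depPart α = P.depPart α + Q.depPart α := by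
    simp [exactAdd, depPart]
  rw [hd, exactAdd, mem_genSet_append]
  constructor
  · rintro ⟨y, hy, z, hz, h⟩
    exact ⟨P.depPart α + y, by simpa using hy, Q.depPart α + z, by simpa using hz, by
      rw [sub_eq_iff_eq_add] at h; rw [h]; abel⟩
  · rintro ⟨y, hy, z, hz, rfl⟩
    exact ⟨_, hy, _, hz, by abel⟩

lemma add_mem_exactAdd {P Q : PolyZonotope ι π} {α : π → ℝ} {x y : ι → ℝ} (hx : x ∈ P.eval α)
    (hy : y ∈ Q.eval α) : x + y ∈ (P.exactAdd Q).eval α :=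
  mem_eval_exactAdd.2 ⟨x, hx, y, hy, rfl⟩

lemma eval_ofZonotope (Z : Zonotope ι) (α : π → ℝ) :
    (ofZonotope Z : PolyZonotope ι π).eval α = Z.toSet := by
  simp [eval, ofZonotope, depPart, mono_zero]

lemma add_mem_addZonotope {P : PolyZonotope ι π} {Z : Zonotope ι} {α : π → ℝ} {x y : ι → ℝ}
    (hx : x ∈ P.eval α) (hy : y ∈ Z.toSet) : x + y ∈ (P.addZonotope Z).eval α := by
  rw [mem_eval] at *
  rw [Zonotope.mem_toSet] at hy
  have h := add_mem_genSet_append hx hy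
  have hd : (P.addZonotope Z).depPart α = Z.center + P.depPart α := by
    simp [addZonotope, depPart, mono_zero]
  rw [hd]
  rwa [show x - P.depPart α + (y - Z.center) = x + y - (Z.center + P.depPart α) by abel] at h

lemma add_mem_translate {P : PolyZonotope ι π} {α : π → ℝ} {x : ι → ℝ} (hx : x ∈ P.eval α)
    (v : ι → ℝ) : x + v ∈ (P.translate v).eval α := by
  rw [mem_eval] at *
  have hd : (P.translate v).depPart α = v + P.depPart α := by
    simp [translate, depPart, mono_zero]
  rw [hd]
  rwa [show x + v - (v + P.depPart α) = x - P.depPart α by abel]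

lemma depPart_map (φ : (ι → ℝ) →ₗ[ℝ] (κ → ℝ)) (P : PolyZonotope ι π) (L : List (κ → ℝ))
    (α : π → ℝ) :
    depPart ⟨P.dep.map fun c => (φ c.1, c.2), L⟩ α = φ (P.depPart α) := by
  simp only [depPart]
  induction P.dep with
  | nil => simp
  | cons c M ih => simp only [List.map_cons, List.sum_cons, ih, map_add, map_smul]

lemma map_mem_eval (φ : (ι → ℝ) →ₗ[ℝ] (κ → ℝ)) {P : PolyZonotope ι π} {α : π → ℝ} {x : ι → ℝ}
    (hx : x ∈ P.eval α) :
    φ x ∈ eval ⟨P.dep.map fun c => (φ c.1, c.2), P.indep.map fun g => φ g⟩ α := by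
  rw [mem_eval] at *
  rw [depPart_map, ← map_sub]
  exact genSet_map φ _ hx

lemma smul_mem_smul {P : PolyZonotope ι π} {α : π → ℝ} {x : ι → ℝ} (hx : x ∈ P.eval α) (a : ℝ) :
    a • x ∈ (P.smul a).eval α := by
  have h := map_mem_eval (LinearMap.lsmul ℝ (ι → ℝ) a) hx
  simp only [LinearMap.lsmul_apply] at h
  exact h

lemma mulVec_mem_mulMat [Fintype ι] {P : PolyZonotope ι π} {α : π → ℝ} {x : ι → ℝ}
    (hx : x ∈ P.eval α) (M : Matrix κ ι ℝ) : M.mulVec x ∈ (P.mulMat M).eval α :=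
  map_mem_eval M.mulVecLin hx

lemma elim_mem_prodZonotope {P : PolyZonotope ι π} {Z : Zonotope κ} {α : π → ℝ} {x : ι → ℝ}
    {y : κ → ℝ} (hx : x ∈ P.eval α) (hy : y ∈ Z.toSet) :
    Sum.elim x y ∈ (P.prodZonotope Z).eval α := by
  rw [mem_eval] at *
  rw [Zonotope.mem_toSet] at hy
  have hd : (P.prodZonotope Z).depPart α = Sum.elim (P.depPart α) Z.center := by
    have h := depPart_map (Zonotope.inlMap ι κ) P [] α
    simp only [depPart, Zonotope.inlMap, LinearMap.coe_mk, AddHom.coe_mk] at h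
    simp only [depPart, prodZonotope, List.map_cons, List.sum_cons, mono_zero, one_smul]
    rw [h]
    ext (i | i) <;> simp
  have h := Zonotope.elim_mem_genSet hx hy
  rw [hd]
  rwa [show Sum.elim (x - P.depPart α) (y - Z.center) =
    Sum.elim x y - Sum.elim (P.depPart α) Z.center by ext (i | i) <;> simp] at h

/-! ### Enclosure by a zonotope -/

lemma sum_mono_smul_mem_genSet {α : π → ℝ} (hα : α ∈ Icc (-1 : π → ℝ) 1)
    (L : List ((ι → ℝ) × (π → ℕ))) :
    (L.map fun c => mono α c.2 • c.1).sum ∈ genSet (L.map Prod.fst) := by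
  induction L with
  | nil => simp [genSet_nil]
  | cons c L ih =>
    exact mem_genSet_cons.2 ⟨_, mono_mem_Icc hα c.2, _, ih, by simp⟩

/-- An even monomial `μ` has values in `[0, 1]`, so `μ = 1/2 + (2μ - 1)/2` with `2μ - 1` in `[-1,
1]`: half the generator goes to the center and half stays a generator. -/
lemma sum_even_mono_smul_mem_genSet {α : π → ℝ} (hα : α ∈ Icc (-1 : π → ℝ) 1)
    (L : List ((ι → ℝ) × (π → ℕ))) (hL : ∀ c ∈ L, ∀ k, Even (c.2 k)) :
    (L.map fun c => mono α c.2 • c.1).sum - (1 / 2 : ℝ) • (L.map Prod.fst).sum ∈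
      genSet (L.map fun c => (1 / 2 : ℝ) • c.1) := by
  induction L with
  | nil => simp [genSet_nil]
  | cons c L ih =>
    have h0 := mono_nonneg_of_even (α := α) (hL c (by simp))
    have h1 := (mono_mem_Icc hα c.2).2
    refine mem_genSet_cons.2 ⟨2 * mono α c.2 - 1, ⟨by linarith, by linarith⟩, _,
      ih fun c hc => hL c (by simp [hc]), ?_⟩
    simp only [List.map_cons, List.sum_cons]
    module

lemma sum_const_mono_smul (α : π → ℝ) (L : List ((ι → ℝ) × (π → ℕ)))
    (hL : ∀ c ∈ L, ∀ k, c.2 k = 0) :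
    (L.map fun c => mono α c.2 • c.1).sum = (L.map Prod.fst).sum := by
  congr 1
  refine List.map_congr_left fun c hc => ?_
  rw [show c.2 = 0 from funext (hL c hc), mono_zero, one_smul]

/-- The enclosing zonotope contains the values for all factors from the unit box. -/
lemma eval_subset_zono (P : PolyZonotope ι π) {α : π → ℝ} (hα : α ∈ Icc (-1 : π → ℝ) 1) :
    P.eval α ⊆ P.zono.toSet := by
  intro x hx
  rw [mem_eval] at hx
  rw [Zonotope.mem_toSet]
  simp only [zono]
  set C := P.dep.filter fun c => decide (∀ k, c.2 k = 0) with hC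
  set V := P.dep.filter fun c => decide ((∀ k, Even (c.2 k)) ∧ ¬ ∀ k, c.2 k = 0) with hV
  set O := P.dep.filter fun c => decide (¬ ∀ k, Even (c.2 k)) with hO
  have hsplit : P.depPart α = (C.map fun c => mono α c.2 • c.1).sum +
      (V.map fun c => mono α c.2 • c.1).sum + (O.map fun c => mono α c.2 • c.1).sum := by
    rw [depPart, hC, hV, hO]
    induction P.dep with
    | nil => simp
    | cons c L ih =>
      by_cases h0 : ∀ k, c.2 k = 0
      · have he : ∀ k, Even (c.2 k) := fun k => by simp [h0 k]
        rw [List.filter_cons_of_pos (by simpa using h0),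
          List.filter_cons_of_neg (by simp only [decide_eq_true_eq]; tauto),
          List.filter_cons_of_neg (by simp only [decide_eq_true_eq]; tauto)]
        simp only [List.map_cons, List.sum_cons, ih]
        abel
      · by_cases he : ∀ k, Even (c.2 k)
        · rw [List.filter_cons_of_neg (by simp only [decide_eq_true_eq]; tauto),
            List.filter_cons_of_pos (by simp only [decide_eq_true_eq]; tauto),
            List.filter_cons_of_neg (by simp only [decide_eq_true_eq]; tauto)]
          simp only [List.map_cons, List.sum_cons, ih]
          abel
        · rw [List.filter_cons_of_neg (by simp only [decide_eq_true_eq]; tauto),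
            List.filter_cons_of_neg (by simp only [decide_eq_true_eq]; tauto),
            List.filter_cons_of_pos (by simp only [decide_eq_true_eq]; tauto)]
          simp only [List.map_cons, List.sum_cons, ih]
          abel
  have h1 := sum_const_mono_smul α C fun c hc => by
    simpa using (List.mem_filter.1 hc).2
  have h2 := sum_even_mono_smul_mem_genSet hα V fun c hc => by
    have := (List.mem_filter.1 hc).2
    simp only [decide_eq_true_eq] at this
    exact this.1
  have h3 := sum_mono_smul_mem_genSet hα O
  have h := add_mem_genSet_append (add_mem_genSet_append h2 h3) hx
  rw [hsplit, h1] at h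
  convert h using 1
  abel

lemma subset_toSet (P : PolyZonotope ι π) {α : π → ℝ} (hα : α ∈ Icc (-1 : π → ℝ) 1) :
    P.eval α ⊆ P.toSet := subset_biUnion_of_mem (u := fun α => P.eval α) hα

/-! ### Quadratic map -/

/-- Appending the independent factors to `α` makes a point of `eval` an exact value, so the
quadratic map can be expanded without loss before anything is enclosed. -/
lemma depPart_allDep (P : PolyZonotope ι π) (α : π → ℝ) (β : Fin P.indep.length → ℝ) :
    P.allDep.depPart (Sum.elim α β) = P.depPart α + ∑ j, β j • P.indep.get j := by
  simp only [depPart, allDep, List.map_append, List.sum_append, List.map_map, List.map_ofFn,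
    List.sum_ofFn]
  congr 1
  · congr 1
    refine List.map_congr_left fun c _ => ?_
    have h : mono β (fun _ => 0) = 1 := mono_zero β
    simp [mono_sumElim, h]
  · refine Finset.sum_congr rfl fun j _ => ?_
    have h : mono α (fun _ => 0) = 1 := mono_zero α
    simp [mono_sumElim, mono_single, h]

/-- Adding exponents multiplies monomials, so the list of all pairs is the expanded product. -/
lemma depPart_sqDep [Fintype ι] (D : κ → Matrix ι ι ℝ) (P : PolyZonotope ι π) (α : π → ℝ) :
    (P.sqDep D).depPart α = quadForm D (P.depPart α) (P.depPart α) := by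
  have hr : ∀ (x : ι → ℝ) (M : List ((ι → ℝ) × (π → ℕ))),
      quadForm D x (M.map fun c => mono α c.2 • c.1).sum =
        (M.map fun c => mono α c.2 • quadForm D x c.1).sum := by
    intro x M
    induction M with
    | nil => simp [quadForm_zero_right]
    | cons c M ih => simp [quadForm_add_right, quadForm_smul_right, ih]
  have hl : ∀ L M : List ((ι → ℝ) × (π → ℕ)),
      ((L.flatMap fun c => M.map fun c' => (quadForm D c.1 c'.1, c.2 + c'.2)).map
        fun c => mono α c.2 • c.1).sum =
      quadForm D (L.map fun c => mono α c.2 • c.1).sum (M.map fun c => mono α c.2 • c.1).sum := by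
    intro L M
    induction L with
    | nil => simp [quadForm_zero_left]
    | cons c L ih =>
      rw [List.flatMap_cons, List.map_append, List.sum_append, ih, List.map_cons, List.sum_cons,
        quadForm_add_left, quadForm_smul_left, hr c.1, List.smul_sum, List.map_map, List.map_map]
      congr 2
      refine List.map_congr_left fun c' _ => ?_
      simp [mono_add, mul_smul]
  exact hl _ _

/-- The quadratic map encloses the quadratic form, for every value of the dependent factors. -/
lemma quadForm_mem_sq [Fintype ι] (D : κ → Matrix ι ι ℝ) {P : PolyZonotope ι π} {α : π → ℝ}
    (hα : α ∈ Icc (-1 : π → ℝ) 1) {x : ι → ℝ} (hx : x ∈ P.eval α) :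
    quadForm D x x ∈ (P.sq D).eval α := by
  obtain ⟨y, ⟨β, hβ, rfl⟩, rfl⟩ := hx
  set γ : π ⊕ Fin P.indep.length → ℝ := Sum.elim α β with hγ
  have hγm : γ ∈ Icc (-1 : π ⊕ Fin P.indep.length → ℝ) 1 := by
    constructor
    · rintro (k | k)
      · exact hα.1 k
      · exact (hβ k).1
    · rintro (k | k)
      · exact hα.2 k
      · exact (hβ k).2
  rw [← depPart_allDep, ← depPart_sqDep]
  simp only [sq]
  set S := P.allDep.sqDep D
  set old := S.dep.filter fun c => decide (∀ j, c.2 (Sum.inr j) = 0) with hold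
  set new := S.dep.filter fun c => decide (¬ ∀ j, c.2 (Sum.inr j) = 0) with hnew
  have hsplit : S.depPart γ = (old.map fun c => mono γ c.2 • c.1).sum +
      (new.map fun c => mono γ c.2 • c.1).sum := by
    rw [depPart, hold, hnew]
    induction S.dep with
    | nil => simp
    | cons c L ih =>
      by_cases h0 : ∀ j, c.2 (Sum.inr j) = 0
      · rw [List.filter_cons_of_pos (by simpa using h0),
          List.filter_cons_of_neg (by simp only [decide_eq_true_eq]; tauto)]
        simp only [List.map_cons, List.sum_cons, ih]
        abel
      · rw [List.filter_cons_of_neg (by simp only [decide_eq_true_eq]; tauto),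
          List.filter_cons_of_pos (by simp only [decide_eq_true_eq]; tauto)]
        simp only [List.map_cons, List.sum_cons, ih]
        abel
  rw [hsplit]
  -- Terms free of `β` depend on `α` alone and stay dependent; the mixed ones are enclosed over the
  -- whole box of `γ`.
  refine add_mem_addZonotope ?_ (eval_subset_zono _ hγm ?_)
  · rw [mem_eval]
    convert zero_mem_genSet _
    rw [sub_eq_zero, depPart, List.map_map]
    congr 1
    refine List.map_congr_left fun c hc => ?_
    have h0 : ∀ j, c.2 (Sum.inr j) = 0 := by simpa using (List.mem_filter.1 hc).2
    have h : mono β (fun _ => 0) = 1 := mono_zero β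
    simp only [hγ, mono_sumElim, h0, h, Function.comp, mul_one]
  · rw [mem_eval]
    convert zero_mem_genSet _
    rw [sub_eq_zero, depPart]

/-! ### Order reduction -/

/-- Order reduction encloses, for every value of the dependent factors. -/
lemma eval_subset_reduce {n : ℕ} (P : PolyZonotope (Fin n) π) (ρ : ℝ) {α : π → ℝ}
    (hα : α ∈ Icc (-1 : π → ℝ) 1) : P.eval α ⊆ (P.reduce ρ).eval α := by
  intro x hx
  simp only [reduce]
  set l : List ((Fin n → ℝ) × (π → ℕ) ⊕ (Fin n → ℝ)) :=
    P.dep.map Sum.inl ++ P.indep.map Sum.inr with hl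
  set sorted := l.insertionSort fun x y => genLength x ≤ genLength y
  set a := min (P.dep.length + P.indep.length)
    ⌈(P.dep.length + P.indep.length : ℝ) - n * (ρ - 1) + 1⌉₊
  have hperm : sorted.Perm l := List.perm_insertionSort _ _
  have hleft : l.filterMap Sum.getLeft? = P.dep := by
    simp [hl, List.filterMap_append, List.filterMap_map, Function.comp_def]
  have hright : l.filterMap Sum.getRight? = P.indep := by
    simp [hl, List.filterMap_append, List.filterMap_map, Function.comp_def]
  -- Wherever the sorted list is cut, the kept and the boxed generators add up exactly to `P` up to
  -- order, with the same `α` in both parts.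
  rw [eval_perm (Q := exactAdd
    ⟨(sorted.drop a).filterMap Sum.getLeft?, (sorted.drop a).filterMap Sum.getRight?⟩
    ⟨(sorted.take a).filterMap Sum.getLeft?, (sorted.take a).filterMap Sum.getRight?⟩)] at hx
  · obtain ⟨y, hy, z, hz, rfl⟩ := mem_eval_exactAdd.1 hx
    exact add_mem_addZonotope hy (Zonotope.toSet_subset_box _ (eval_subset_zono _ hα hz))
  · refine List.Perm.trans ?_ List.perm_append_comm
    rw [← List.filterMap_append, List.take_append_drop]
    conv_lhs => rw [← hleft]
    exact (hperm.filterMap _).symm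
  · refine List.Perm.trans ?_ List.perm_append_comm
    rw [← List.filterMap_append, List.take_append_drop]
    conv_lhs => rw [← hright]
    exact (hperm.filterMap _).symm

end PolyZonotope

/-! ## Taylor expansion -/

section Taylor

variable {ζ : Type} [Fintype ζ] [DecidableEq ζ] {n : ℕ}

/-- Only the first slot is expanded in the standard basis. Currying that slot away makes the next
one first, so expansions in two and three slots follow by repetition. -/
lemma multilinear_vecCons_eq_sum {F : Type} [NormedAddCommGroup F] [NormedSpace ℝ F] {k : ℕ}
    (M : ContinuousMultilinearMap ℝ (fun _ : Fin (k + 1) => ζ → ℝ) F) (d : ζ → ℝ)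
    (v : Fin k → ζ → ℝ) :
    M (Matrix.vecCons d v) = ∑ j, d j • M (Matrix.vecCons (Pi.single j 1) v) := by
  have h := congrArg (fun φ : ContinuousMultilinearMap ℝ (fun _ : Fin k => ζ → ℝ) F => φ v)
    (congrArg M.curryLeft (pi_eq_sum_univ' d))
  simpa [map_sum, _root_.sum_apply, Matrix.vecCons] using h

lemma fderiv_apply_eq_sum (f : (ζ → ℝ) → Fin n → ℝ) (z d : ζ → ℝ) (i : Fin n) :
    fderiv ℝ f z d i = ∑ j, partial1 f z i j * d j := by
  have h := congrArg (fun v => fderiv ℝ f z v i) (pi_eq_sum_univ' d)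
  simpa [partial1, map_sum, mul_comm] using h

lemma iteratedFDeriv_two_eq_sum (f : (ζ → ℝ) → Fin n → ℝ) (z d d' : ζ → ℝ) (i : Fin n) :
    iteratedFDeriv ℝ 2 f z ![d, d'] i = d ⬝ᵥ (partial2 f z i).mulVec d' := by
  rw [multilinear_vecCons_eq_sum, Finset.sum_apply, dotProduct]
  refine Finset.sum_congr rfl fun j _ => ?_
  have h := multilinear_vecCons_eq_sum
    ((iteratedFDeriv ℝ 2 f z).curryLeft (Pi.single j 1)) d' ![]
  simp only [ContinuousMultilinearMap.curryLeft_apply] at h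
  change iteratedFDeriv ℝ 2 f z ![Pi.single j 1, d'] =
    ∑ k, d' k • iteratedFDeriv ℝ 2 f z ![Pi.single j 1, Pi.single k 1] at h
  rw [h]
  simp [partial2, Matrix.mulVec, dotProduct, mul_comm]

lemma iteratedFDeriv_three_eq_sum (f : (ζ → ℝ) → Fin n → ℝ) (z d : ζ → ℝ) (i : Fin n) :
    iteratedFDeriv ℝ 3 f z ![d, d, d] i =
      ∑ j, ∑ k, ∑ l, partial3 f z i j k l * (d j * (d k * d l)) := by
  rw [multilinear_vecCons_eq_sum, Finset.sum_apply]
  refine Finset.sum_congr rfl fun j _ => ?_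
  have h := multilinear_vecCons_eq_sum
    ((iteratedFDeriv ℝ 3 f z).curryLeft (Pi.single j 1)) d ![d]
  simp only [ContinuousMultilinearMap.curryLeft_apply] at h
  change iteratedFDeriv ℝ 3 f z ![Pi.single j 1, d, d] =
    ∑ k, d k • iteratedFDeriv ℝ 3 f z ![Pi.single j 1, Pi.single k 1, d] at h
  rw [h, Pi.smul_apply, Finset.sum_apply, Finset.smul_sum]
  refine Finset.sum_congr rfl fun k _ => ?_
  have h := multilinear_vecCons_eq_sum
    (((iteratedFDeriv ℝ 3 f z).curryLeft (Pi.single j 1)).curryLeft (Pi.single k 1)) d ![]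
  simp only [ContinuousMultilinearMap.curryLeft_apply] at h
  change iteratedFDeriv ℝ 3 f z ![Pi.single j 1, Pi.single k 1, d] =
    ∑ l, d l • iteratedFDeriv ℝ 3 f z ![Pi.single j 1, Pi.single k 1, Pi.single l 1] at h
  rw [h, Pi.smul_apply, Finset.sum_apply, Finset.smul_sum, Finset.smul_sum]
  refine Finset.sum_congr rfl fun l _ => ?_
  simp [partial3]
  ring

/-- Merges the two cross terms of the quadratic part at `z - zs` when it is sorted by powers of `z`.
-/
lemma partial2_symm {f : (ζ → ℝ) → Fin n → ℝ} (hf : ContDiff ℝ 3 f) (z x y : ζ → ℝ) (i : Fin n) :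
    quadForm (partial2 f z) x y i = quadForm (partial2 f z) y x i := by
  unfold quadForm
  rw [← iteratedFDeriv_two_eq_sum, ← iteratedFDeriv_two_eq_sum, iteratedFDeriv_two_apply,
    iteratedFDeriv_two_apply]
  have h : IsSymmSndFDerivAt ℝ f z :=
    (hf.contDiffAt).isSymmSndFDerivAt (by simp; norm_num)
  exact congrFun (h.eq x y) i

/-- Third-order expansion along a segment with the Lagrange form of the remainder. -/
lemma exists_taylor_lagrange {f : (ζ → ℝ) → Fin n → ℝ} (hf : ContDiff ℝ 3 f) (zs z : ζ → ℝ)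
    (i : Fin n) :
    ∃ θ ∈ Icc (0 : ℝ) 1, f z i = f zs i + ∑ j, partial1 f zs i j * (z - zs) j +
      (1 / 2) * quadForm (partial2 f zs) (z - zs) (z - zs) i +
      (1 / 6) * ∑ j, ∑ k, ∑ l, partial3 f (zs + θ • (z - zs)) i j k l *
        ((z - zs) j * ((z - zs) k * (z - zs) l)) := by
  set d := z - zs with hd
  set φ : (ζ → ℝ) → ℝ := fun y => f y i with hφ
  have hφc : ContDiff ℝ 3 φ := (contDiff_pi.1 hf) i
  have hcomp : ∀ k : ℕ, k ≤ 3 → ∀ y v, iteratedFDeriv ℝ k φ y v = iteratedFDeriv ℝ k f y v i := by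
    intro k hk y v
    have h := (ContinuousLinearMap.proj (R := ℝ) (φ := fun _ : Fin n => ℝ) i).iteratedFDeriv_comp_left
      (f := f) (x := y) (i := k) (hf.contDiffAt) (by exact_mod_cast hk)
    change iteratedFDeriv ℝ k φ y = _ at h
    rw [h]
    rfl
  -- Restricting one component to the segment from `zs` to `z` reduces the claim to the scalar
  -- Taylor theorem on `[0, 1]`. The intermediate point `θ` therefore depends on the component.
  set g : ℝ → ℝ := fun θ => φ (zs + θ • d) with hg
  have hgc : ContDiff ℝ 3 g := hφc.comp (by fun_prop)
  have hit : ∀ k : ℕ, k ≤ 3 → iteratedDeriv k g =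
      fun θ => iteratedFDeriv ℝ k φ (zs + θ • d) (fun _ => d) := by
    intro k
    induction k with
    | zero => intro _; ext θ; simp [hg]
    | succ k ih =>
      intro hk
      ext θ
      rw [iteratedDeriv_succ, ih (by omega)]
      exact ContDiffAt.deriv_fderiv_add_smul (hφc.contDiffAt.of_le (by exact_mod_cast hk))
  obtain ⟨θ, hθ, h⟩ := taylor_mean_remainder_lagrange_iteratedDeriv (f := g) (n := 2)
    (x := 1) (x₀ := 0) zero_ne_one (by exact_mod_cast hgc.contDiffOn)
  rw [uIoo_of_lt zero_lt_one] at hθ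
  refine ⟨θ, ⟨hθ.1.le, hθ.2.le⟩, ?_⟩
  have hw : ∀ k : ℕ, k ≤ 3 → iteratedDerivWithin k g (uIcc 0 1) 0 =
      iteratedFDeriv ℝ k f zs (fun _ => d) i := by
    intro k hk
    rw [iteratedDerivWithin_eq_iteratedDeriv (uniqueDiffOn_uIcc zero_ne_one)
      (hgc.contDiffAt.of_le (by exact_mod_cast hk)) (by simp), hit k hk]
    beta_reduce
    rw [hcomp k hk]
    simp
  have v1 : (fun _ : Fin 1 => d) = ![d] := by ext j; fin_cases j; rfl
  have v2 : (fun _ : Fin 2 => d) = ![d, d] := by ext j; fin_cases j <;> rfl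
  have v3 : (fun _ : Fin 3 => d) = ![d, d, d] := by ext j; fin_cases j <;> rfl
  have h1 : iteratedFDeriv ℝ 1 f zs (fun _ => d) i = ∑ j, partial1 f zs i j * d j := by
    rw [← fderiv_apply_eq_sum, iteratedFDeriv_one_apply]
  have h2 : iteratedFDeriv ℝ 2 f zs (fun _ => d) i = quadForm (partial2 f zs) d d i := by
    rw [v2, iteratedFDeriv_two_eq_sum]; rfl
  have h3 : iteratedDeriv 3 g θ = ∑ j, ∑ k, ∑ l, partial3 f (zs + θ • d) i j k l *
      (d j * (d k * d l)) := by
    rw [hit 3 le_rfl]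
    beta_reduce
    rw [← iteratedFDeriv_three_eq_sum, ← v3, ← hcomp 3 le_rfl]
  have hg1 : g 1 = f z i := by simp [hg, hφ, hd]
  have hg0 : g 0 = f zs i := by simp [hg, hφ]
  simp only [taylorWithinEval_succ, taylor_within_zero_eval, hw 1 (by norm_num),
    hw 2 (by norm_num), zero_add, one_add_one_eq_two, hg1, hg0, h1, h2] at h
  rw [show (2 + 1 : ℕ) = 3 from rfl, h3] at h
  norm_num [Nat.factorial] at h ⊢
  linarith

end Taylor

/-! ## Interval arithmetic -/

section Interval

/-- For one fixed factor the product is monotone or antitone in the other, so its extremes are at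
endpoints (`key`). Applying this in `x` and then in `y` at both ends of `a` reaches the four
corners. -/
lemma mul_mem_intervalMul {a b : ℝ × ℝ} {x y : ℝ} (hx : x ∈ Icc a.1 a.2) (hy : y ∈ Icc b.1 b.2) :
    x * y ∈ Icc (intervalMul a b).1 (intervalMul a b).2 := by
  obtain ⟨a1, a2⟩ := a
  obtain ⟨b1, b2⟩ := b
  simp only [intervalMul, mem_Icc] at *
  obtain ⟨hx1, hx2⟩ := hx
  obtain ⟨hy1, hy2⟩ := hy
  have key : ∀ t u v w : ℝ, u ≤ v → v ≤ w → min (t * u) (t * w) ≤ t * v ∧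
      t * v ≤ max (t * u) (t * w) := by
    intro t u v w huv hvw
    rcases le_total 0 t with ht | ht
    · exact ⟨min_le_of_left_le (by gcongr), le_max_of_le_right (by gcongr)⟩
    · exact ⟨min_le_of_right_le (mul_le_mul_of_nonpos_left hvw ht),
        le_max_of_le_left (mul_le_mul_of_nonpos_left huv ht)⟩
  obtain ⟨h1, h2⟩ := key y a1 x a2 hx1 hx2
  obtain ⟨h3, h4⟩ := key a1 b1 y b2 hy1 hy2
  obtain ⟨h5, h6⟩ := key a2 b1 y b2 hy1 hy2
  rw [mul_comm y x, mul_comm y a1, mul_comm y a2] at h1 h2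
  exact ⟨le_trans (min_le_min h3 h5) h1, le_trans h2 (max_le_max h4 h6)⟩

/-- Compactness makes the image bounded, so that `sInf` and `sSup` are genuine bounds and not
default values. -/
lemma mem_rangeOn {ζ : Type} {g : (ζ → ℝ) → ℝ} (hg : Continuous g) {X : Set (ζ → ℝ)}
    (hX : IsCompact X) {x : ζ → ℝ} (hx : x ∈ X) :
    g x ∈ Icc (rangeOn g X).1 (rangeOn g X).2 :=
  ⟨csInf_le (hX.image hg).bddBelow (mem_image_of_mem g hx),
    le_csSup (hX.image hg).bddAbove (mem_image_of_mem g hx)⟩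

/-- A separate `θ` for each component suffices because the enclosure is a box. The intermediate
point lies in the box around the enclosure and `zs` by convexity. -/
lemma mem_lagrangeRemainder {n : ℕ} {ζ π : Type} [Fintype ζ] [Fintype π] {R : PolyZonotope ζ π}
    {E : (ζ → ℝ) → Fin n → ζ → ζ → ζ → ℝ} (hE : ∀ i j k l, Continuous fun ξ => E ξ i j k l)
    {zs z : ζ → ℝ} (hz : z ∈ R.zono.toSet) {y : Fin n → ℝ}
    (hy : ∀ i, ∃ θ ∈ Icc (0 : ℝ) 1, y i = (1 / 6) * ∑ j, ∑ k, ∑ l,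
      E (zs + θ • (z - zs)) i j k l * ((z - zs) j * ((z - zs) k * (z - zs) l))) :
    y ∈ (lagrangeRemainder R E zs).toSet := by
  have hlo := Zonotope.lower_le hz
  have hhi := Zonotope.le_upper hz
  have hδ : ∀ j, (z - zs) j ∈ Icc (R.zono.lower j - zs j) (R.zono.upper j - zs j) := fun j =>
    ⟨sub_le_sub_right (hlo j) _, sub_le_sub_right (hhi j) _⟩
  have key : ∀ i j k l, ∀ θ ∈ Icc (0 : ℝ) 1,
      E (zs + θ • (z - zs)) i j k l * ((z - zs) j * ((z - zs) k * (z - zs) l)) ∈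
      Icc (intervalMul (rangeOn (fun ξ => E ξ i j k l)
          (Icc (R.zono.lower ⊓ zs) (R.zono.upper ⊔ zs)))
        (intervalMul (R.zono.lower j - zs j, R.zono.upper j - zs j)
          (intervalMul (R.zono.lower k - zs k, R.zono.upper k - zs k)
            (R.zono.lower l - zs l, R.zono.upper l - zs l)))).1
      (intervalMul (rangeOn (fun ξ => E ξ i j k l)
          (Icc (R.zono.lower ⊓ zs) (R.zono.upper ⊔ zs)))
        (intervalMul (R.zono.lower j - zs j, R.zono.upper j - zs j)
          (intervalMul (R.zono.lower k - zs k, R.zono.upper k - zs k)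
            (R.zono.lower l - zs l, R.zono.upper l - zs l)))).2 := by
    intro i j k l θ hθ
    refine mul_mem_intervalMul (mem_rangeOn (hE i j k l) isCompact_Icc ?_)
      (mul_mem_intervalMul (hδ j) (mul_mem_intervalMul (hδ k) (hδ l)))
    have hc := (convex_Icc (R.zono.lower ⊓ zs) (R.zono.upper ⊔ zs)).add_smul_sub_mem
      (x := zs) (y := z) ⟨inf_le_right, le_sup_right⟩
      ⟨inf_le_left.trans hlo, hhi.trans le_sup_left⟩ hθ
    exact hc
  refine Zonotope.mem_box (fun i => ?_) (fun i => ?_)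
  · obtain ⟨θ, hθ, h⟩ := hy i
    simp only [h, Prod.smul_fst, Prod.fst_sum, smul_eq_mul]
    gcongr with j _ k _ l _
    exact (key i j k l θ hθ).1
  · obtain ⟨θ, hθ, h⟩ := hy i
    simp only [h, Prod.smul_snd, Prod.snd_sum, smul_eq_mul]
    gcongr with j _ k _ l _
    exact (key i j k l θ hθ).2

end Interval

/-- The dynamics equals its second-order Taylor polynomial, sorted by powers, plus the Lagrange
remainder. -/
lemma exists_taylor_remainder {n m : ℕ} {f : (Fin n ⊕ Fin m → ℝ) → Fin n → ℝ}
    (hf : ContDiff ℝ 3 f) (zs : Fin n ⊕ Fin m → ℝ) (x : Fin n → ℝ) (u : Fin m → ℝ) (i : Fin n) :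
    ∃ θ ∈ Icc (0 : ℝ) 1, f (Sum.elim x u) i - ((taylor f zs).w + (taylor f zs).A.mulVec x +
      (taylor f zs).B.mulVec u + (1 / 2 : ℝ) • quadForm (taylor f zs).D (Sum.elim x u)
        (Sum.elim x u)) i = (1 / 6) * ∑ j, ∑ k, ∑ l,
          (taylor f zs).E (zs + θ • (Sum.elim x u - zs)) i j k l * ((Sum.elim x u - zs) j *
            ((Sum.elim x u - zs) k * (Sum.elim x u - zs) l)) := by
  obtain ⟨θ, hθ, h⟩ := exists_taylor_lagrange hf zs (Sum.elim x u) i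
  refine ⟨θ, hθ, ?_⟩
  rw [h]
  set z : Fin n ⊕ Fin m → ℝ := Sum.elim x u with hz
  have hlin : (taylor f zs).A.mulVec x i + (taylor f zs).B.mulVec u i =
      ∑ j, partial1 f zs i j * z j - quadForm (partial2 f zs) z zs i := by
    simp only [Matrix.mulVec, dotProduct, taylor, Matrix.of_apply, quadForm,
      Fintype.sum_sum_type, hz, Sum.elim_inl, Sum.elim_inr, sub_mul, Finset.sum_sub_distrib]
    simp only [mul_comm (x _), mul_comm (u _)]
    ring
  have hquad : quadForm (partial2 f zs) (z - zs) (z - zs) i = quadForm (partial2 f zs) z z i -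
      2 * quadForm (partial2 f zs) z zs i + quadForm (partial2 f zs) zs zs i := by
    have h1 : z - zs = z + (-1 : ℝ) • zs := by simp [sub_eq_add_neg]
    rw [h1]
    simp only [quadForm_add_left, quadForm_add_right, quadForm_smul_left, quadForm_smul_right,
      Pi.add_apply, Pi.smul_apply, smul_eq_mul, partial2_symm hf zs zs z i]
    ring
  have hw : (taylor f zs).w i = f zs i - ∑ j, partial1 f zs i j * zs j +
      (1 / 2) * quadForm (partial2 f zs) zs zs i := rfl
  have hD : (taylor f zs).D = partial2 f zs := rfl
  have hE : (taylor f zs).E = partial3 f := rfl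
  simp only [Pi.add_apply, Pi.smul_apply, smul_eq_mul, hD, hE, hw, hquad, Pi.sub_apply, mul_sub,
    Finset.sum_sub_distrib] at hlin ⊢
  linarith

lemma continuous_partial3 {n : ℕ} {ζ : Type} [Fintype ζ] [DecidableEq ζ]
    {f : (ζ → ℝ) → Fin n → ℝ} (hf : ContDiff ℝ 3 f) (i : Fin n) (j k l : ζ) :
    Continuous fun ξ => partial3 f ξ i j k l := by
  have h : Continuous fun ξ => iteratedFDeriv ℝ 3 f ξ :=
    hf.continuous_iteratedFDeriv (m := 3) le_rfl
  have h2 : Continuous fun ξ =>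
      iteratedFDeriv ℝ 3 f ξ ![Pi.single j 1, Pi.single k 1, Pi.single l 1] :=
    (ContinuousEvalConst.continuous_eval_const _).comp h
  exact (continuous_apply i).comp h2

/-! ## Matrix exponential -/

section Exponential

variable {n : ℕ} (A : Matrix (Fin n) (Fin n) ℝ)

section Norm

attribute [local instance] Matrix.linftyOpNormedRing Matrix.linftyOpNormedAlgebra

lemma hasSum_expMat (t : ℝ) :
    HasSum (fun i : ℕ => (t ^ i / (i.factorial : ℝ)) • A ^ i) (expMat A t) := by
  have h := NormedSpace.exp_series_hasSum_exp' (𝕂 := ℝ) (t • A)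
  have e : (fun i : ℕ => (t ^ i / (i.factorial : ℝ)) • A ^ i) =
      fun i : ℕ => (i.factorial : ℝ)⁻¹ • (t • A) ^ i := by
    funext i
    rw [smul_pow, smul_smul]
    congr 1
    ring
  rw [e]
  exact h

lemma hasDerivAt_expMat_apply (t : ℝ) (i j : Fin n) :
    HasDerivAt (fun t => expMat A t i j) ((expMat A t * A) i j) t := by
  have h := hasDerivAt_exp_smul_const (𝕂 := ℝ) A t
  have hc : Continuous fun M : Matrix (Fin n) (Fin n) ℝ => M i j := by fun_prop
  let φ : Matrix (Fin n) (Fin n) ℝ →L[ℝ] ℝ :=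
    ⟨⟨⟨fun M => M i j, fun _ _ => rfl⟩, fun _ _ => rfl⟩, hc⟩
  exact φ.hasFDerivAt.comp_hasDerivAt t h

end Norm

lemma expMat_zero : expMat A 0 = 1 := by
  simp [expMat]

lemma expMat_add (s t : ℝ) : expMat A (s + t) = expMat A s * expMat A t := by
  unfold expMat
  rw [add_smul, Matrix.exp_add_of_commute]
  exact ((Commute.refl A).smul_left s).smul_right t

lemma expMat_mul_neg (t : ℝ) : expMat A t * expMat A (-t) = 1 := by
  rw [← expMat_add, add_neg_cancel, expMat_zero]

lemma continuous_expMat : Continuous (expMat A) :=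
  continuous_matrix fun i j => continuous_iff_continuousAt.2 fun t =>
    (hasDerivAt_expMat_apply A t i j).continuousAt

/-- Remainder of the exponential series of `A t` after the power `η`. -/
noncomputable def remMat (η : ℕ) (t : ℝ) : Matrix (Fin n) (Fin n) ℝ :=
  expMat A t - ∑ i ∈ Finset.range (η + 1), (t ^ i / (i.factorial : ℝ)) • A ^ i

lemma continuous_remMat (η : ℕ) : Continuous (remMat A η) := by
  unfold remMat
  have := continuous_expMat A
  fun_prop

lemma expMat_eq_sum_add_remMat (η : ℕ) (t : ℝ) : expMat A t =
    ∑ i ∈ Finset.range (η + 1), (t ^ i / (i.factorial : ℝ)) • A ^ i + remMat A η t := by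
  simp [remMat]

lemma hasSum_apply {f : ℕ → Matrix (Fin n) (Fin n) ℝ} {S : Matrix (Fin n) (Fin n) ℝ}
    (h : HasSum f S) (j k : Fin n) : HasSum (fun i => f i j k) (S j k) :=
  Pi.hasSum.1 (Pi.hasSum.1 h j) k

lemma abs_pow_apply_le (i : ℕ) (j k : Fin n) : |(A ^ i) j k| ≤ (matAbs A ^ i) j k := by
  induction i generalizing j k with
  | zero => by_cases h : j = k <;> simp [h]
  | succ i ih =>
    rw [pow_succ, pow_succ, Matrix.mul_apply, Matrix.mul_apply]
    refine (Finset.abs_sum_le_sum_abs _ _).trans (Finset.sum_le_sum fun l _ => ?_)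
    rw [abs_mul]
    exact mul_le_mul_of_nonneg_right (ih j l) (abs_nonneg _)

/-- Entrywise bound of the tail of a power series that is dominated by the exponential series. -/
lemma abs_sub_sum_le_expRem {r : ℝ} {η : ℕ} {c : ℕ → ℝ}
    {S : Matrix (Fin n) (Fin n) ℝ} (hS : HasSum (fun i => c i • A ^ i) S)
    (hc : ∀ i, η < i → |c i| ≤ r ^ i / (i.factorial : ℝ)) (j k : Fin n) :
    |(S - ∑ i ∈ Finset.range (η + 1), c i • A ^ i) j k| ≤ expRem A r η j k := by
  have h1 := hasSum_apply ((hasSum_nat_add_iff' (η + 1)).2 hS) j k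
  have h2 := hasSum_apply ((hasSum_nat_add_iff' (η + 1)).2 (hasSum_expMat (matAbs A) r)) j k
  have hb : ∀ i, |(c (i + (η + 1)) • A ^ (i + (η + 1))) j k| ≤
      ((r ^ (i + (η + 1)) / ((i + (η + 1)).factorial : ℝ)) • matAbs A ^ (i + (η + 1))) j k := by
    intro i
    simp only [Matrix.smul_apply, smul_eq_mul]
    rw [abs_mul]
    have := hc (i + (η + 1)) (by omega)
    exact mul_le_mul this (abs_pow_apply_le A _ j k) (abs_nonneg _) ((abs_nonneg _).trans this)
  rw [abs_le]
  exact ⟨hasSum_le (fun i => (abs_le.1 (hb i)).1) h2.neg h1,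
    hasSum_le (fun i => (abs_le.1 (hb i)).2) h1 h2⟩

lemma abs_remMat_le {r t : ℝ} (η : ℕ) (ht : t ∈ Icc 0 r) (j k : Fin n) :
    |remMat A η t j k| ≤ expRem A r η j k := by
  refine abs_sub_sum_le_expRem A (hasSum_expMat A t) (fun i _ => ?_) j k
  have h0 := ht.1
  rw [abs_of_nonneg (by positivity)]
  gcongr
  exact ht.2

lemma expRem_nonneg {r : ℝ} (hr : 0 ≤ r) (η : ℕ) (j k : Fin n) : 0 ≤ expRem A r η j k :=
  (abs_nonneg _).trans (abs_remMat_le A η ⟨le_rfl, hr⟩ j k)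

/-- The difference is itself a tail, with coefficients `(sⁱ - s) rⁱ / i!`. As `|sⁱ - s| ≤ 1`, one
copy of `W` is enough where the triangle inequality would give more. -/
lemma abs_remMat_sub_smul_le {r s : ℝ} (η : ℕ) (hr : 0 ≤ r) (hs : s ∈ Icc (0 : ℝ) 1)
    (j k : Fin n) :
    |(remMat A η (s * r) - s • remMat A η r) j k| ≤ expRem A r η j k := by
  have h := (hasSum_expMat A (s * r)).sub ((hasSum_expMat A r).const_smul s)
  have h' : HasSum (fun i : ℕ => (((s ^ i - s) * r ^ i) / (i.factorial : ℝ)) • A ^ i)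
      (expMat A (s * r) - s • expMat A r) := by
    have e : (fun i : ℕ => (((s ^ i - s) * r ^ i) / (i.factorial : ℝ)) • A ^ i) = fun i : ℕ =>
        ((s * r) ^ i / (i.factorial : ℝ)) • A ^ i - s • (r ^ i / (i.factorial : ℝ)) • A ^ i := by
      funext i
      rw [smul_smul, ← sub_smul]
      congr 1
      ring
    rw [e]
    exact h
  have := abs_sub_sum_le_expRem A h' (η := η) (r := r) (fun i hi => ?_) j k
  · have e : remMat A η (s * r) - s • remMat A η r = expMat A (s * r) - s • expMat A r -
        ∑ i ∈ Finset.range (η + 1), ((s ^ i - s) * r ^ i / (i.factorial : ℝ)) • A ^ i := by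
      simp only [remMat, smul_sub, Finset.smul_sum]
      rw [sub_sub_sub_comm, ← Finset.sum_sub_distrib]
      congr 1
      refine Finset.sum_congr rfl fun i _ => ?_
      rw [smul_smul, ← sub_smul]
      congr 1
      ring
    rw [e]
    exact this
  · rw [abs_div, abs_mul, abs_of_nonneg (by positivity : (0 : ℝ) ≤ r ^ i),
      abs_of_nonneg (by positivity : (0 : ℝ) ≤ (i.factorial : ℝ))]
    gcongr
    refine mul_le_of_le_one_left (by positivity) ?_
    have h1 : s ^ i ≤ s := pow_le_of_le_one hs.1 hs.2 (by omega)
    have h2 : 0 ≤ s ^ i := pow_nonneg hs.1 i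
    rw [abs_le]
    constructor <;> linarith [hs.2]

end Exponential

/-! ## Curvature of monomials -/

/-- The minimizer of `sⁱ - s` is `σ = i^{-1/(i-1)}`, where `i σⁱ = σ`, and `curvature i = σⁱ - σ`.
Bernoulli's inequality at `s / σ` is the tangent bound `sⁱ ≥ σⁱ + (s - σ)`. -/
lemma curvature_le {i : ℕ} (hi : 2 ≤ i) {s : ℝ} (hs : s ∈ Icc (0 : ℝ) 1) :
    curvature i ≤ s ^ i - s := by
  have hi' : (2 : ℝ) ≤ i := by exact_mod_cast hi
  have hi0 : (0 : ℝ) < i := by linarith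
  set σ : ℝ := (i : ℝ) ^ (-1 / ((i : ℝ) - 1)) with hσ
  have hσ0 : 0 < σ := Real.rpow_pos_of_pos hi0 _
  have hpow : (i : ℝ) ^ (-(i : ℝ) / ((i : ℝ) - 1)) = σ ^ i := by
    rw [hσ, ← Real.rpow_natCast, ← Real.rpow_mul hi0.le]
    congr 1
    ring
  have hcrit : (i : ℝ) * σ ^ i = σ := by
    rw [← hpow]
    nth_rewrite 1 [← Real.rpow_one (i : ℝ)]
    rw [← Real.rpow_add hi0, hσ]
    congr 1
    have : (i : ℝ) - 1 ≠ 0 := by linarith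
    field_simp
    ring
  have hb := one_add_mul_le_pow (a := s / σ - 1) (by
    have : 0 ≤ s / σ := div_nonneg hs.1 hσ0.le
    linarith) i
  have hb2 := mul_le_mul_of_nonneg_left hb (pow_nonneg hσ0.le i)
  rw [add_sub_cancel, ← mul_pow, mul_div_cancel₀ _ hσ0.ne'] at hb2
  have he : σ ^ i * (1 + i * (s / σ - 1)) = σ ^ i + s - σ := by
    have : σ ^ i * (1 + i * (s / σ - 1)) = σ ^ i + (i * σ ^ i) * (s / σ - 1) := by ring
    rw [this, hcrit]
    field_simp
    ring
  rw [he] at hb2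
  unfold curvature
  rw [hpow]
  linarith

lemma abs_pow_sub_sub_curvature_le {i : ℕ} (hi : 2 ≤ i) {s : ℝ} (hs : s ∈ Icc (0 : ℝ) 1) :
    |s ^ i - s - curvature i / 2| ≤ |curvature i| / 2 := by
  have h1 := curvature_le hi hs
  have h2 : s ^ i ≤ s := pow_le_of_le_one hs.1 hs.2 (by omega)
  rw [abs_of_nonpos (a := curvature i) (by linarith), abs_le]
  constructor <;> linarith

/-- Coefficients of the form `(sⁱ - s) rⁱ / i!` deviate from the center of their range by at most
its radius. -/
lemma abs_coeff_sub_le {r s : ℝ} (hr : 0 ≤ r) (hs : s ∈ Icc (0 : ℝ) 1) {i : ℕ} (hi : 2 ≤ i) :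
    |(s ^ i - s) * r ^ i / (i.factorial : ℝ) - curvature i * r ^ i / (2 * (i.factorial : ℝ))| ≤
      |curvature i| * r ^ i / (2 * (i.factorial : ℝ)) := by
  have h := mul_le_mul_of_nonneg_right (abs_pow_sub_sub_curvature_le hi hs)
    (by positivity : 0 ≤ r ^ i / (i.factorial : ℝ))
  rw [← abs_of_nonneg (by positivity : 0 ≤ r ^ i / (i.factorial : ℝ)), ← abs_mul,
    abs_of_nonneg (by positivity : 0 ≤ r ^ i / (i.factorial : ℝ))] at h
  calc _ = |(s ^ i - s - curvature i / 2) * (r ^ i / (i.factorial : ℝ))| := by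
        congr 1
        field_simp
    _ ≤ |curvature i| / 2 * (r ^ i / (i.factorial : ℝ)) := h
    _ = _ := by field_simp

lemma abs_sum_smul_sub_le {n : ℕ} {s : Finset ℕ} {a b c : ℕ → ℝ}
    {M : ℕ → Matrix (Fin n) (Fin n) ℝ} (h : ∀ i ∈ s, |a i - b i| ≤ c i) (j k : Fin n) :
    |(∑ i ∈ s, a i • M i - ∑ i ∈ s, b i • M i) j k| ≤ (∑ i ∈ s, c i • matAbs (M i)) j k := by
  rw [← Finset.sum_sub_distrib, Matrix.sum_apply, Matrix.sum_apply]
  refine (Finset.abs_sum_le_sum_abs _ _).trans (Finset.sum_le_sum fun i hi => ?_)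
  rw [← sub_smul, Matrix.smul_apply, smul_eq_mul, abs_mul]
  exact mul_le_mul_of_nonneg_right (h i hi) (abs_nonneg _)

/-! ## Integrals of vector-valued functions -/

section Integral

variable {n : ℕ}

lemma intervalIntegrable_apply {φ : ℝ → Fin n → ℝ} {a b : ℝ}
    (hφ : IntervalIntegrable φ volume a b) (i : Fin n) :
    IntervalIntegrable (fun s => φ s i) volume a b := by
  let p : (Fin n → ℝ) →L[ℝ] ℝ := ContinuousLinearMap.proj i
  exact ⟨p.integrable_comp hφ.1, p.integrable_comp hφ.2⟩

lemma integral_apply {φ : ℝ → Fin n → ℝ} {a b : ℝ}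
    (hφ : IntervalIntegrable φ volume a b) (i : Fin n) :
    (∫ s in a..b, φ s) i = ∫ s in a..b, φ s i :=
  ((ContinuousLinearMap.proj (R := ℝ) (φ := fun _ : Fin n => ℝ)
    i).intervalIntegral_comp_comm hφ).symm

lemma mulVec_integral (M : Matrix (Fin n) (Fin n) ℝ) {φ : ℝ → Fin n → ℝ} {a b : ℝ}
    (hφ : IntervalIntegrable φ volume a b) :
    M.mulVec (∫ s in a..b, φ s) = ∫ s in a..b, M.mulVec (φ s) :=
  ((LinearMap.toContinuousLinearMap M.mulVecLin).intervalIntegral_comp_comm hφ).symm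

lemma intervalIntegrable_mulVec {M : ℝ → Matrix (Fin n) (Fin n) ℝ} (hM : Continuous M)
    {φ : ℝ → Fin n → ℝ} {a b : ℝ} (hφ : IntervalIntegrable φ volume a b) :
    IntervalIntegrable (fun s => (M s).mulVec (φ s)) volume a b := by
  have e : (fun s => (M s).mulVec (φ s)) = ∑ j, fun s => φ s j • (M s).col j := by
    ext s i
    simp [Matrix.mulVec, dotProduct, mul_comm]
  rw [e]
  refine IntervalIntegrable.sum _ fun j _ => ?_
  refine IntervalIntegrable.smul_continuousOn (intervalIntegrable_apply hφ j) ?_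
  have : Continuous fun s => (M s).col j := by
    refine continuous_pi fun i => ?_
    exact hM.matrix_elem i j
  exact this.continuousOn

lemma integral_mulVec_const {M : ℝ → Matrix (Fin n) (Fin n) ℝ} (hM : Continuous M)
    (v : Fin n → ℝ) (a b : ℝ) :
    ∫ s in a..b, (M s).mulVec v = (Matrix.of fun i j => ∫ s in a..b, M s i j).mulVec v := by
  ext i
  rw [integral_apply (intervalIntegrable_mulVec hM (by simp))]
  simp only [Matrix.mulVec, dotProduct, Matrix.of_apply]
  rw [intervalIntegral.integral_finsetSum]
  · simp [intervalIntegral.integral_mul_const]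
  · intro j _
    exact ((hM.matrix_elem i j).mul continuous_const).intervalIntegrable _ _

/-- A weighted integral of points of a closed convex set is the integral of the weight times a
point of the set. -/
lemma exists_integral_smul_eq {K : Set (Fin n → ℝ)} (hK : Convex ℝ K) (hKc : IsClosed K)
    {ψ : ℝ → Fin n → ℝ} {t : ℝ} (ht : 0 < t) (hψ : IntervalIntegrable ψ volume 0 t)
    (hψK : ∀ s ∈ Icc 0 t, ψ s ∈ K) {w : ℝ → ℝ} (hw : Continuous w) (hw0 : ∀ s ∈ Icc 0 t, 0 ≤ w s)
    (hpos : 0 < ∫ s in (0 : ℝ)..t, w s) :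
    ∃ p ∈ K, ∫ s in (0 : ℝ)..t, w s • ψ s = (∫ s in (0 : ℝ)..t, w s) • p := by
  set c := ∫ s in (0 : ℝ)..t, w s with hc
  -- Normalized by `c`, the weight is a probability density on `(0, t]`; the required `p` is the
  -- mean of `ψ`, which lies in `K` by convexity and closedness.
  set ν : Measure ℝ := volume.restrict (Ioc 0 t) with hν
  set d : ℝ → ENNReal := fun s => ENNReal.ofReal (w s / c) with hd
  have hdm : Measurable d := by fun_prop
  have hw0' : ∀ᵐ s ∂ν, 0 ≤ w s / c := by
    filter_upwards [ae_restrict_mem measurableSet_Ioc] with s hs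
    exact div_nonneg (hw0 s ⟨hs.1.le, hs.2⟩) hpos.le
  have hwi : Integrable (fun s => w s / c) ν := by
    have := (hw.intervalIntegrable (μ := volume) 0 t).1
    exact this.div_const c
  have hint : ∫⁻ s, d s ∂ν = 1 := by
    rw [hd, ← ofReal_integral_eq_lintegral_ofReal hwi hw0', integral_div, hν,
      ← intervalIntegral.integral_of_le ht.le, ← hc, div_self hpos.ne', ENNReal.ofReal_one]
  have hprob : IsProbabilityMeasure (ν.withDensity d) := ⟨by
    rw [withDensity_apply _ MeasurableSet.univ, Measure.restrict_univ, hint]⟩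
  have hfin : ∀ᵐ s ∂ν, d s < ⊤ := ae_of_all _ fun s => ENNReal.ofReal_lt_top
  have hmul : Integrable (fun s => (w s / c) • ψ s) ν := by
    have := (hψ.continuousOn_smul (f := fun s => w s / c)
      (hw.div_const c).continuousOn).1
    exact this
  have hcongr : (fun s => (d s).toReal • ψ s) =ᵐ[ν] fun s => (w s / c) • ψ s := by
    filter_upwards [hw0'] with s hs
    rw [hd]
    simp only [ENNReal.toReal_ofReal hs]
  refine ⟨∫ s, ψ s ∂(ν.withDensity d), hK.integral_mem hKc ?_ ?_, ?_⟩
  · refine (withDensity_absolutelyContinuous ν d).ae_le ?_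
    filter_upwards [ae_restrict_mem measurableSet_Ioc] with s hs
    exact hψK s ⟨hs.1.le, hs.2⟩
  · rw [integrable_withDensity_iff_integrable_smul' hdm hfin]
    exact hmul.congr hcongr.symm
  · rw [integral_withDensity_eq_integral_toReal_smul hdm hfin, integral_congr_ae hcongr,
      ← integral_smul, intervalIntegral.integral_of_le ht.le]
    refine integral_congr_ae (ae_of_all _ fun s => ?_)
    simp only [smul_smul]
    rw [mul_div_cancel₀ _ hpos.ne']

lemma integral_sub_pow_div_factorial (i : ℕ) (t : ℝ) :
    ∫ s in (0 : ℝ)..t, (t - s) ^ i / (i.factorial : ℝ) = t ^ (i + 1) / ((i + 1).factorial : ℝ) := by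
  rw [intervalIntegral.integral_div, intervalIntegral.integral_comp_sub_left (fun s => s ^ i),
    integral_pow, Nat.factorial_succ]
  push_cast
  simp
  field_simp

end Integral

/-! ## Enclosure of the solutions of linear systems -/

section Linear

variable {n : ℕ}

lemma Zonotope.sum_add_mem_foldr {ι : Type} (l : List ℕ) {Z : ℕ → Zonotope ι} {Z₀ : Zonotope ι}
    {v : ℕ → ι → ℝ} {y : ι → ℝ} (hv : ∀ i ∈ l, v i ∈ (Z i).toSet) (hy : y ∈ Z₀.toSet) :
    (l.map v).sum + y ∈ ((l.map Z).foldr Zonotope.add Z₀).toSet := by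
  induction l with
  | nil => simpa using hy
  | cons i l ih =>
    rw [List.map_cons, List.map_cons, List.sum_cons, List.foldr_cons, add_assoc]
    exact Zonotope.add_mem_add (hv i (by simp)) (ih fun j hj => hv j (by simp [hj]))

/-- The integral `∫₀ᵗ e^{A(t-s)} ψ(s) ds`. -/
noncomputable def convExp (A : Matrix (Fin n) (Fin n) ℝ) (ψ : ℝ → Fin n → ℝ) (t : ℝ) :
    Fin n → ℝ :=
  ∫ s in (0 : ℝ)..t, (expMat A (t - s)).mulVec (ψ s)

/-- Expand `e^{A(t-s)}` under the integral. Term `i` is `Aⁱ` times a weighted integral of `ψ` with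
total weight `tⁱ⁺¹/(i+1)!`, that is, this weight times a point of `Ψ`. Passing from `t` to `r` costs
the factor `(t/r)ⁱ⁺¹`, which `hscale` absorbs: trivially for `t = r`, and by convexity if `Ψ`
contains the origin. -/
lemma convExp_mem_inputSolution (A : Matrix (Fin n) (Fin n) ℝ) (η : ℕ) {Ψ : Zonotope (Fin n)}
    {r t : ℝ} (hr : 0 < r) (ht : t ∈ Icc 0 r) {ψ : ℝ → Fin n → ℝ}
    (hψ : IntervalIntegrable ψ volume 0 t) (hψΨ : ∀ s ∈ Icc 0 t, ψ s ∈ Ψ.toSet)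
    (hscale : ∀ p ∈ Ψ.toSet, ∀ i : ℕ, (t / r) ^ i • p ∈ Ψ.toSet) :
    convExp A ψ t ∈ (inputSolution A η Ψ r).toSet := by
  have hterm : ∀ i : ℕ, ∃ p ∈ Ψ.toSet, ∫ s in (0 : ℝ)..t, ((t - s) ^ i / (i.factorial : ℝ)) • ψ s =
      (r ^ (i + 1) / ((i + 1).factorial : ℝ)) • p := by
    intro i
    rcases ht.1.eq_or_lt with h0 | h0
    -- For `t = 0` the weight has no mass to normalize; both sides vanish.
    · refine ⟨(t / r) ^ (i + 1) • Ψ.center, hscale _ Ψ.center_mem _, ?_⟩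
      simp [← h0]
    · obtain ⟨p, hp, h⟩ := exists_integral_smul_eq Ψ.convex_toSet Ψ.isClosed_toSet h0 hψ hψΨ
        (w := fun s => (t - s) ^ i / (i.factorial : ℝ)) (by fun_prop)
        (fun s hs => div_nonneg (pow_nonneg (sub_nonneg.2 hs.2) _) (by positivity))
        (by rw [integral_sub_pow_div_factorial]; positivity)
      refine ⟨(t / r) ^ (i + 1) • p, hscale p hp _, ?_⟩
      rw [h, integral_sub_pow_div_factorial, smul_smul]
      congr 1
      rw [div_pow]
      field_simp
  choose p hp hpi using hterm
  have hrem : Continuous fun s => remMat A η (t - s) :=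
    (continuous_remMat A η).comp (by fun_prop)
  have hpow : ∀ i, IntervalIntegrable (fun s => ((t - s) ^ i / (i.factorial : ℝ)) • ψ s)
      volume 0 t := fun i => hψ.continuousOn_smul (by fun_prop)
  set ρ := ∫ s in (0 : ℝ)..t, (remMat A η (t - s)).mulVec (ψ s) with hρ
  have hsplit : convExp A ψ t = ∑ i ∈ Finset.range (η + 1),
      ((r ^ (i + 1) / ((i + 1).factorial : ℝ)) • A ^ i).mulVec (p i) + ρ := by
    unfold convExp
    have e : ∀ s, (expMat A (t - s)).mulVec (ψ s) = ∑ i ∈ Finset.range (η + 1),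
        (A ^ i).mulVec (((t - s) ^ i / (i.factorial : ℝ)) • ψ s) +
          (remMat A η (t - s)).mulVec (ψ s) := by
      intro s
      rw [expMat_eq_sum_add_remMat A η, Matrix.add_mulVec, Matrix.sum_mulVec]
      congr 1
      refine Finset.sum_congr rfl fun i _ => ?_
      rw [Matrix.smul_mulVec, Matrix.mulVec_smul]
    have hi : ∀ i, IntervalIntegrable
        (fun s => (A ^ i).mulVec (((t - s) ^ i / (i.factorial : ℝ)) • ψ s)) volume 0 t :=
      fun i => intervalIntegrable_mulVec continuous_const (hpow i)
    simp_rw [e]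
    rw [intervalIntegral.integral_add (by
        simpa [Finset.sum_fn] using IntervalIntegrable.sum (Finset.range (η + 1)) fun i _ => hi i)
      (intervalIntegrable_mulVec hrem hψ),
      intervalIntegral.integral_finsetSum fun i _ => hi i]
    congr 1
    refine Finset.sum_congr rfl fun i _ => ?_
    rw [← mulVec_integral _ (hpow i), hpi, Matrix.smul_mulVec, Matrix.mulVec_smul]
  have hρb : ∀ i, |ρ i| ≤ (r • expRem A r η).mulVec Ψ.absBound i := by
    intro i
    have hab : ∀ j, 0 ≤ Ψ.absBound j := fun j =>
      (abs_nonneg _).trans (Zonotope.abs_le_absBound Ψ.center_mem j)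
    rw [hρ, integral_apply (intervalIntegrable_mulVec hrem hψ)]
    have := intervalIntegral.norm_integral_le_of_norm_le_const (a := 0) (b := t)
      (C := (expRem A r η).mulVec Ψ.absBound i)
      (f := fun s => (remMat A η (t - s)).mulVec (ψ s) i) (fun s hs => by
        rw [uIoc_of_le ht.1] at hs
        exact Zonotope.abs_mulVec_le (hψΨ s ⟨hs.1.le, hs.2⟩)
          (fun j k => abs_remMat_le A η ⟨by linarith [hs.2], by linarith [hs.1, ht.2]⟩ j k) i)
    rw [Real.norm_eq_abs, sub_zero, abs_of_nonneg ht.1] at this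
    refine this.trans ?_
    rw [Matrix.smul_mulVec, Pi.smul_apply, smul_eq_mul, mul_comm]
    refine mul_le_mul_of_nonneg_right ht.2 ?_
    simp only [Matrix.mulVec, dotProduct]
    exact Finset.sum_nonneg fun j _ => mul_nonneg (expRem_nonneg A hr.le η i j) (hab j)
  have hmem := Zonotope.sum_add_mem_foldr (List.range (η + 1))
    (fun i _ => Zonotope.mulVec_mem_mulMat (hp i)
      ((r ^ (i + 1) / ((i + 1).factorial : ℝ)) • A ^ i))
    (Zonotope.mulVec_add_mem_mulIntervalMat (C := 0) Ψ.center_mem hρb)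
  rw [Matrix.zero_mulVec, zero_add] at hmem
  rw [hsplit]
  exact hmem

lemma gammaMat_mulVec (A : Matrix (Fin n) (Fin n) ℝ) (t : ℝ) (c : Fin n → ℝ) :
    (gammaMat A t).mulVec c = convExp A (fun _ => c) t :=
  (integral_mulVec_const (M := fun s => expMat A (t - s))
    ((continuous_expMat A).comp (by fun_prop)) c 0 t).symm

/-- Substituting `t - s` for `s` leaves `t` only in the upper limit of the remainder integral, so
that values at different times can be compared. -/
lemma gammaMat_eq (A : Matrix (Fin n) (Fin n) ℝ) (η : ℕ) (t : ℝ) :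
    gammaMat A t = ∑ i ∈ Finset.range (η + 1),
      (t ^ (i + 1) / ((i + 1).factorial : ℝ)) • A ^ i +
        Matrix.of fun i j => ∫ s in (0 : ℝ)..t, remMat A η s i j := by
  ext i j
  simp only [gammaMat, Matrix.of_apply, Matrix.add_apply, Matrix.sum_apply, Matrix.smul_apply,
    smul_eq_mul]
  have e : ∀ s, expMat A (t - s) i j = ∑ k ∈ Finset.range (η + 1),
      (t - s) ^ k / (k.factorial : ℝ) * (A ^ k) i j + remMat A η (t - s) i j := by
    intro s
    rw [expMat_eq_sum_add_remMat A η]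
    simp [Matrix.sum_apply]
  have hrem : Continuous fun s => remMat A η (t - s) i j :=
    ((continuous_remMat A η).matrix_elem i j).comp (by fun_prop)
  simp_rw [e]
  rw [intervalIntegral.integral_add (Continuous.intervalIntegrable (by fun_prop) _ _)
    (hrem.intervalIntegrable _ _), intervalIntegral.integral_finsetSum
      fun k _ => Continuous.intervalIntegrable (by fun_prop) _ _,
    intervalIntegral.integral_comp_sub_left (fun s => remMat A η s i j)]
  simp only [sub_self, sub_zero, intervalIntegral.integral_mul_const,
    integral_sub_pow_div_factorial]

/-- Linear interpolation is exact on the term of degree one (`h1`), so the curvature sums start at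
`2`. -/
lemma sum_coeff_eq_sum_Icc (A : Matrix (Fin n) (Fin n) ℝ) (η : ℕ) (g : ℕ → ℝ) (h1 : g 1 = 0) :
    ∑ i ∈ Finset.range (η + 1), g i • A ^ i =
      g 0 • 1 + ∑ i ∈ Finset.Icc 2 η, g i • A ^ i := by
  rw [Finset.sum_range_succ', pow_zero, add_comm]
  congr 1
  rw [Finset.range_eq_Ico, Finset.sum_Ico_add' (fun i => g i • A ^ i)]
  symm
  refine Finset.sum_subset (fun i hi => by simp at hi ⊢; omega) fun i hi hi' => ?_
  have : i = 1 := by simp at hi hi'; omega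
  simp [this, h1]

/-- Integration raises the power of time but not that of `A`: the coefficient of index `i` goes with
`A ^ (i - 1)`, and the sum runs to `η + 1`. -/
lemma sum_coeff_succ_eq_sum_Icc (A : Matrix (Fin n) (Fin n) ℝ) (η : ℕ) (g : ℕ → ℝ)
    (h1 : g 1 = 0) :
    ∑ i ∈ Finset.range (η + 1), g (i + 1) • A ^ i =
      ∑ i ∈ Finset.Icc 2 (η + 1), g i • A ^ (i - 1) := by
  have e : ∀ i, g (i + 1) • A ^ i = g (i + 1) • A ^ (i + 1 - 1) := fun i => by simp
  simp_rw [e]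
  rw [Finset.range_eq_Ico, Finset.sum_Ico_add' (fun i => g i • A ^ (i - 1))]
  symm
  refine Finset.sum_subset (fun i hi => by simp at hi ⊢; omega) fun i hi hi' => ?_
  have : i = 1 := by simp at hi hi'; omega
  simp [this, h1]

/-- The deviation of `e^{At}` from linear interpolation is enclosed by the interval matrix `F`. -/
lemma abs_expMat_sub_interp_le (A : Matrix (Fin n) (Fin n) ℝ) (η : ℕ) {r s : ℝ} (hr : 0 ≤ r)
    (hs : s ∈ Icc (0 : ℝ) 1) (j k : Fin n) :
    |((expMat A (s * r) - 1 - s • (expMat A r - 1)) - ∑ i ∈ Finset.Icc 2 η,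
      (curvature i * r ^ i / (2 * (i.factorial : ℝ))) • A ^ i) j k| ≤
    (∑ i ∈ Finset.Icc 2 η, (|curvature i| * r ^ i / (2 * (i.factorial : ℝ))) • matAbs (A ^ i) +
      expRem A r η) j k := by
  set g : ℕ → ℝ := fun i => (s ^ i - s) * r ^ i / (i.factorial : ℝ) with hg
  have e : expMat A (s * r) - 1 - s • (expMat A r - 1) =
      ∑ i ∈ Finset.Icc 2 η, g i • A ^ i + (remMat A η (s * r) - s • remMat A η r) := by
    have h := sum_coeff_eq_sum_Icc A η g (by simp [hg])
    have h2 : ∑ i ∈ Finset.range (η + 1), g i • A ^ i =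
        ∑ i ∈ Finset.range (η + 1), ((s * r) ^ i / (i.factorial : ℝ)) • A ^ i -
          s • ∑ i ∈ Finset.range (η + 1), (r ^ i / (i.factorial : ℝ)) • A ^ i := by
      rw [Finset.smul_sum, ← Finset.sum_sub_distrib]
      refine Finset.sum_congr rfl fun i _ => ?_
      rw [smul_smul, ← sub_smul]
      congr 1
      simp only [hg]
      ring
    rw [h2] at h
    -- The constant term cancels against `-1 + s` from the two subtracted identities.
    have h0 : g 0 = 1 - s := by simp [hg]
    rw [h0] at h
    rw [expMat_eq_sum_add_remMat A η (s * r), expMat_eq_sum_add_remMat A η r,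
      eq_sub_of_add_eq' h.symm]
    module
  rw [e, add_sub_right_comm, Matrix.add_apply, Matrix.add_apply]
  refine (abs_add_le _ _).trans (add_le_add ?_ (abs_remMat_sub_smul_le A η hr hs j k))
  exact abs_sum_smul_sub_le (fun i hi => abs_coeff_sub_le hr hs (Finset.mem_Icc.1 hi).1) j k

/-- Cutting the long integral at `s r` gives `(1 - s) I - s J`, where `|I| ≤ W s r` and `|J| ≤ W (1
- s) r`. The total is at most `2 s (1 - s) r W`. -/
lemma abs_integral_remMat_sub_le (A : Matrix (Fin n) (Fin n) ℝ) (η : ℕ) {r s : ℝ} (hr : 0 ≤ r)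
    (hs : s ∈ Icc (0 : ℝ) 1) (j k : Fin n) :
    |(∫ τ in (0 : ℝ)..(s * r), remMat A η τ j k) - s * ∫ τ in (0 : ℝ)..r, remMat A η τ j k| ≤
      r * expRem A r η j k := by
  have hc : Continuous fun τ => remMat A η τ j k := (continuous_remMat A η).matrix_elem j k
  have h0 : 0 ≤ s * r := mul_nonneg hs.1 hr
  have h1 : s * r ≤ r := mul_le_of_le_one_left hr hs.2
  have hW := expRem_nonneg A hr η j k
  have b1 := intervalIntegral.norm_integral_le_of_norm_le_const (a := 0) (b := s * r)
    (C := expRem A r η j k) (f := fun τ => remMat A η τ j k) fun τ hτ => by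
      rw [uIoc_of_le h0] at hτ
      exact abs_remMat_le A η ⟨hτ.1.le, hτ.2.trans h1⟩ j k
  have b2 := intervalIntegral.norm_integral_le_of_norm_le_const (a := s * r) (b := r)
    (C := expRem A r η j k) (f := fun τ => remMat A η τ j k) fun τ hτ => by
      rw [uIoc_of_le h1] at hτ
      exact abs_remMat_le A η ⟨h0.trans hτ.1.le, hτ.2⟩ j k
  rw [← intervalIntegral.integral_add_adjacent_intervals (hc.intervalIntegrable 0 (s * r))
    (hc.intervalIntegrable (s * r) r)]
  rw [Real.norm_eq_abs, sub_zero, abs_of_nonneg h0] at b1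
  rw [Real.norm_eq_abs, abs_of_nonneg (sub_nonneg.2 h1)] at b2
  set I := ∫ τ in (0 : ℝ)..(s * r), remMat A η τ j k
  set J := ∫ τ in (s * r)..r, remMat A η τ j k
  set W := expRem A r η j k
  have hs1 : 0 ≤ 1 - s := sub_nonneg.2 hs.2
  calc |I - s * (I + J)| = |(1 - s) * I - s * J| := by congr 1; ring
    _ ≤ |(1 - s) * I| + |s * J| := abs_sub _ _
    _ = (1 - s) * |I| + s * |J| := by rw [abs_mul, abs_mul, abs_of_nonneg hs1, abs_of_nonneg hs.1]
    _ ≤ (1 - s) * (W * (s * r)) + s * (W * (r - s * r)) := by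
      gcongr
      exact hs.1
    _ = (2 * s * (1 - s)) * (r * W) := by ring
    _ ≤ r * W := mul_le_of_le_one_left (mul_nonneg hr hW) (by nlinarith [sq_nonneg (2 * s - 1)])

/-- The deviation of `Γ(t)` from linear interpolation is enclosed by the interval matrix `F'`. -/
lemma abs_gammaMat_sub_interp_le (A : Matrix (Fin n) (Fin n) ℝ) (η : ℕ) {r s : ℝ} (hr : 0 ≤ r)
    (hs : s ∈ Icc (0 : ℝ) 1) (j k : Fin n) :
    |((gammaMat A (s * r) - s • gammaMat A r) - ∑ i ∈ Finset.Icc 2 (η + 1),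
      (curvature i * r ^ i / (2 * (i.factorial : ℝ))) • A ^ (i - 1)) j k| ≤
    (∑ i ∈ Finset.Icc 2 (η + 1),
      (|curvature i| * r ^ i / (2 * (i.factorial : ℝ))) • matAbs (A ^ (i - 1)) +
      r • expRem A r η) j k := by
  set g : ℕ → ℝ := fun i => (s ^ i - s) * r ^ i / (i.factorial : ℝ) with hg
  have e : gammaMat A (s * r) - s • gammaMat A r =
      ∑ i ∈ Finset.Icc 2 (η + 1), g i • A ^ (i - 1) +
        ((Matrix.of fun i j => ∫ τ in (0 : ℝ)..(s * r), remMat A η τ i j) -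
          s • Matrix.of fun i j => ∫ τ in (0 : ℝ)..r, remMat A η τ i j) := by
    rw [← sum_coeff_succ_eq_sum_Icc A η g (by simp [hg])]
    have h2 : ∑ i ∈ Finset.range (η + 1), g (i + 1) • A ^ i =
        ∑ i ∈ Finset.range (η + 1), ((s * r) ^ (i + 1) / ((i + 1).factorial : ℝ)) • A ^ i -
          s • ∑ i ∈ Finset.range (η + 1), (r ^ (i + 1) / ((i + 1).factorial : ℝ)) • A ^ i := by
      rw [Finset.smul_sum, ← Finset.sum_sub_distrib]
      refine Finset.sum_congr rfl fun i _ => ?_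
      rw [smul_smul, ← sub_smul]
      congr 1
      simp only [hg]
      ring
    rw [h2, gammaMat_eq A η (s * r), gammaMat_eq A η r]
    module
  rw [e, add_sub_right_comm, Matrix.add_apply, Matrix.add_apply]
  refine (abs_add_le _ _).trans (add_le_add ?_ (abs_integral_remMat_sub_le A η hr hs j k))
  exact abs_sum_smul_sub_le (fun i hi => abs_coeff_sub_le hr hs (Finset.mem_Icc.1 hi).1) j k

lemma convExp_add (A : Matrix (Fin n) (Fin n) ℝ) {φ ψ : ℝ → Fin n → ℝ} {t : ℝ}
    (hφ : IntervalIntegrable φ volume 0 t) (hψ : IntervalIntegrable ψ volume 0 t) :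
    convExp A (φ + ψ) t = convExp A φ t + convExp A ψ t := by
  have hM : Continuous fun s => expMat A (t - s) := (continuous_expMat A).comp (by fun_prop)
  unfold convExp
  rw [← intervalIntegral.integral_add (intervalIntegrable_mulVec hM hφ)
    (intervalIntegrable_mulVec hM hψ)]
  simp [Matrix.mulVec_add]

/-- Enclosure of the deviation from the initial state over a time step. -/
lemma mem_postDelta {π : Type} [Fintype π] (R : PolyZonotope (Fin n) π) (Ψ : Zonotope (Fin n))
    (A : Matrix (Fin n) (Fin n) ℝ) (η : ℕ) {r t : ℝ} (hr : 0 < r) (ht : t ∈ Icc 0 r)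
    {x₀ : Fin n → ℝ} (hx₀ : x₀ ∈ R.zono.toSet) {ψ : ℝ → Fin n → ℝ}
    (hψ : IntervalIntegrable ψ volume 0 t) (hψΨ : ∀ s ∈ Icc 0 t, ψ s ∈ Ψ.toSet) :
    (expMat A t).mulVec x₀ + convExp A ψ t - x₀ ∈ (postDelta R Ψ A η r).toSet := by
  -- `s` is the fraction of the step. The deviation splits into the `s`-fold deviation at time `r`,
  -- the two interpolation errors of `e^{At}` and `Γ(t)`, and the centered input.
  obtain ⟨s, rfl⟩ : ∃ s, t = s * r := ⟨t / r, by field_simp⟩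
  have hs : s ∈ Icc (0 : ℝ) 1 :=
    ⟨nonneg_of_mul_nonneg_left ht.1 hr, (mul_le_iff_le_one_left hr).1 ht.2⟩
  have hψ' : IntervalIntegrable (fun τ => ψ τ - Ψ.center) volume 0 (s * r) :=
    hψ.sub intervalIntegrable_const
  have hin := convExp_mem_inputSolution A η (Ψ := Ψ.centered) hr ht hψ'
    (fun τ hτ => Zonotope.sub_center_mem_centered (hψΨ τ hτ)) (fun p hp i => by
      have : s * r / r = s := by field_simp
      rw [this]
      have h := Ψ.centered.convex_toSet.smul_mem_of_zero_mem Ψ.zero_mem_centered hp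
        (t := s ^ i) ⟨pow_nonneg hs.1 _, pow_le_one₀ hs.1 hs.2⟩
      exact h)
  have hhom := Zonotope.smul_mem_hullOrigin (Zonotope.add_mem_translate
    (Zonotope.mulVec_mem_mulMat hx₀ (expMat A r - 1)) ((gammaMat A r).mulVec Ψ.center)) hs
  have hF := Zonotope.mulVec_mem_mulIntervalMat hx₀ (abs_expMat_sub_interp_le A η hr.le hs)
  have hc : Ψ.center ∈ Zonotope.toSet ⟨Ψ.center, []⟩ :=
    Zonotope.center_mem ⟨Ψ.center, []⟩
  have hF' := Zonotope.mulVec_mem_mulIntervalMat hc (abs_gammaMat_sub_interp_le A η hr.le hs)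
  have h := Zonotope.add_mem_add (Zonotope.add_mem_add (Zonotope.add_mem_add hhom hF) hF') hin
  have hsplit : convExp A ψ (s * r) = (gammaMat A (s * r)).mulVec Ψ.center +
      convExp A (fun τ => ψ τ - Ψ.center) (s * r) := by
    rw [gammaMat_mulVec, ← convExp_add A intervalIntegrable_const hψ']
    congr 1
    ext τ
    simp
  have e : (expMat A (s * r)).mulVec x₀ + convExp A ψ (s * r) - x₀ =
      s • ((expMat A r - 1).mulVec x₀ + (gammaMat A r).mulVec Ψ.center) +
      (expMat A (s * r) - 1 - s • (expMat A r - 1)).mulVec x₀ +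
      (gammaMat A (s * r) - s • gammaMat A r).mulVec Ψ.center +
      convExp A (fun τ => ψ τ - Ψ.center) (s * r) := by
    rw [hsplit]
    simp only [Matrix.sub_mulVec, Matrix.smul_mulVec, Matrix.one_mulVec]
    module
  rw [e]
  exact h

end Linear

/-! ## Variation of constants -/

section VariationOfConstants

variable {n : ℕ}

lemma absolutelyContinuousOnInterval_const (c a b : ℝ) :
    AbsolutelyContinuousOnInterval (fun _ => c) a b :=
  contDiff_const.contDiffOn.absolutelyContinuousOnInterval

lemma absolutelyContinuousOnInterval_sum {ι : Type} (s : Finset ι) {g : ι → ℝ → ℝ} {a b : ℝ}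
    (h : ∀ i ∈ s, AbsolutelyContinuousOnInterval (g i) a b) :
    AbsolutelyContinuousOnInterval (fun t => ∑ i ∈ s, g i t) a b := by
  classical
  induction s using Finset.induction_on with
  | empty => simpa using absolutelyContinuousOnInterval_const 0 a b
  | insert i s hi ih =>
    simp only [Finset.sum_insert hi]
    exact (h i (by simp)).add (ih fun j hj => h j (by simp [hj]))

lemma contDiff_expMat_neg_apply (A : Matrix (Fin n) (Fin n) ℝ) (i j : Fin n) :
    ContDiff ℝ 1 fun t => expMat A (-t) i j := by
  have hd : ∀ t, HasDerivAt (fun t => expMat A (-t) i j) (-(expMat A (-t) * A) i j) t := by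
    intro t
    simpa [Function.comp_def] using (hasDerivAt_expMat_apply A (-t) i j).comp t (hasDerivAt_neg t)
  refine contDiff_one_iff_deriv.2 ⟨fun t => (hd t).differentiableAt, ?_⟩
  have e : (deriv fun t => expMat A (-t) i j) = fun t => -(expMat A (-t) * A) i j :=
    funext fun t => (hd t).deriv
  rw [e]
  have := (continuous_expMat A).comp continuous_neg
  exact ((this.matrix_mul continuous_const).matrix_elem i j).neg

/-- With `e^{At}` pulled out, `t` occurs only in the upper limit of the integral, which makes
continuity and differentiation in `t` accessible. -/
lemma convExp_eq (A : Matrix (Fin n) (Fin n) ℝ) {ψ : ℝ → Fin n → ℝ} {t : ℝ}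
    (hψ : IntervalIntegrable ψ volume 0 t) :
    convExp A ψ t = (expMat A t).mulVec (∫ s in (0 : ℝ)..t, (expMat A (-s)).mulVec (ψ s)) := by
  have hM : Continuous fun s => expMat A (-s) := (continuous_expMat A).comp continuous_neg
  rw [mulVec_integral _ (intervalIntegrable_mulVec hM hψ)]
  unfold convExp
  simp only [Matrix.mulVec_mulVec, ← expMat_add, sub_eq_add_neg]

lemma continuous_convExp (A : Matrix (Fin n) (Fin n) ℝ) {ψ : ℝ → Fin n → ℝ}
    (hψ : ∀ a b, IntervalIntegrable ψ volume a b) : Continuous (convExp A ψ) := by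
  have hM : Continuous fun s => expMat A (-s) := (continuous_expMat A).comp continuous_neg
  have e : convExp A ψ =
      fun t => (expMat A t).mulVec (∫ s in (0 : ℝ)..t, (expMat A (-s)).mulVec (ψ s)) :=
    funext fun t => convExp_eq A (hψ 0 t)
  rw [e]
  exact (continuous_expMat A).matrix_mulVec
    (intervalIntegral.continuous_primitive (fun a b => intervalIntegrable_mulVec hM (hψ a b)) 0)

/-- Variation of constants for integrable right-hand sides. -/
lemma eq_expMat_mulVec_add_convExp (A : Matrix (Fin n) (Fin n) ℝ) {φ x : ℝ → Fin n → ℝ}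
    {x₀ : Fin n → ℝ} {T : ℝ} (hT : 0 ≤ T) (hx : Continuous x)
    (hφ : IntervalIntegrable φ volume 0 T)
    (h : ∀ t ∈ Icc 0 T, x t = x₀ + ∫ s in (0 : ℝ)..t, φ s) :
    x T = (expMat A T).mulVec x₀ + convExp A (fun s => φ s - A.mulVec (x s)) T := by
  have hM : Continuous fun s => expMat A (-s) := (continuous_expMat A).comp continuous_neg
  have hAx : Continuous fun s => A.mulVec (x s) := continuous_const.matrix_mulVec hx
  have hψ : IntervalIntegrable (fun s => φ s - A.mulVec (x s)) volume 0 T :=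
    hφ.sub (hAx.intervalIntegrable _ _)
  set ψ := fun s => φ s - A.mulVec (x s) with hψdef
  have hEψ := intervalIntegrable_mulVec hM hψ
  have hu : uIcc 0 T = Icc 0 T := uIcc_of_le hT
  have key : ∀ i, (expMat A (-T)).mulVec (x T) i = x₀ i +
      ∫ s in (0 : ℝ)..T, (expMat A (-s)).mulVec (ψ s) i := by
    intro i
    -- The primitive agrees with `x` on `[0, T]` and is defined, absolutely continuous and almost
    -- everywhere differentiable there without endpoint issues.
    set X : Fin n → ℝ → ℝ := fun j t => x₀ j + ∫ s in (0 : ℝ)..t, φ s j with hX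
    have hXx : ∀ j, ∀ t ∈ Icc 0 T, X j t = x t j := by
      intro j t ht
      have hs : uIcc 0 t ⊆ uIcc 0 T := by
        rw [uIcc_of_le ht.1, hu]
        exact Icc_subset_Icc_right ht.2
      rw [h t ht, Pi.add_apply, integral_apply (hφ.mono_set hs)]
    have hφi := fun j => intervalIntegrable_apply hφ j
    have hEψi := intervalIntegrable_apply hEψ i
    -- Since `φ` is merely integrable, the product rule holds only almost everywhere. Absolute
    -- continuity is what turns the zero derivative into constancy of `q`.
    set q : ℝ → ℝ := fun t => ∑ j, expMat A (-t) i j * X j t -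
      ∫ s in (0 : ℝ)..t, (expMat A (-s)).mulVec (ψ s) i with hq
    have hac : AbsolutelyContinuousOnInterval q 0 T := by
      refine AbsolutelyContinuousOnInterval.sub (absolutelyContinuousOnInterval_sum _ fun j _ =>
        AbsolutelyContinuousOnInterval.mul
          (contDiff_expMat_neg_apply A i j).contDiffOn.absolutelyContinuousOnInterval ?_) ?_
      · exact (absolutelyContinuousOnInterval_const _ _ _).add
          ((hφi j).absolutelyContinuousOnInterval_intervalIntegral (by simp))
      · exact hEψi.absolutelyContinuousOnInterval_intervalIntegral (by simp)
    have hder : ∀ᵐ t, t ∈ uIcc 0 T → HasDerivAt q 0 t := by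
      have h1 : ∀ᵐ t, ∀ j, t ∈ uIcc 0 T → ∀ c ∈ uIcc 0 T,
          HasDerivAt (fun t => ∫ s in c..t, φ s j) (φ t j) t :=
        ae_all_iff.2 fun j => (hφi j).ae_hasDerivAt_integral
      filter_upwards [h1, hEψi.ae_hasDerivAt_integral] with t ht1 ht2 ht
      have hE : ∀ j, HasDerivAt (fun t => expMat A (-t) i j) (-(expMat A (-t) * A) i j) t := by
        intro j
        simpa [Function.comp_def] using
          (hasDerivAt_expMat_apply A (-t) i j).comp t (hasDerivAt_neg t)
      have hXd : ∀ j, HasDerivAt (X j) (φ t j) t := fun j =>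
        (ht1 j ht 0 (by simp)).const_add _
      have hd := (HasDerivAt.fun_sum fun j (_ : j ∈ Finset.univ) => (hE j).mul (hXd j)).sub
        (ht2 ht 0 (by simp))
      refine hd.congr_deriv ?_
      have e1 : ∑ j, (expMat A (-t) * A) i j * X j t =
          (expMat A (-t)).mulVec (A.mulVec (x t)) i := by
        rw [Matrix.mulVec_mulVec, Matrix.mulVec, dotProduct]
        exact Finset.sum_congr rfl fun j _ => by rw [hXx j t (hu ▸ ht)]
      have e2 : ∑ j, expMat A (-t) i j * φ t j = (expMat A (-t)).mulVec (φ t) i := rfl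
      simp only [hψdef, Matrix.mulVec_sub, Pi.sub_apply, neg_mul, Finset.sum_add_distrib,
        Finset.sum_neg_distrib, e1, e2]
      ring
    obtain ⟨C, hC⟩ := hac.const_of_ae_hasDerivAt_zero hder
    have h0 := hC 0 (by simp)
    have hTC := hC T (by simp)
    have hq0 : q 0 = x₀ i := by
      simp [hq, hX, expMat_zero, Matrix.one_apply]
    have hqT : q T = (expMat A (-T)).mulVec (x T) i -
        ∫ s in (0 : ℝ)..T, (expMat A (-s)).mulVec (ψ s) i := by
      simp only [hq, Matrix.mulVec, dotProduct]
      congr 1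
      exact Finset.sum_congr rfl fun j _ => by rw [hXx j T ⟨hT, le_rfl⟩]
    linarith
  have key2 : (expMat A (-T)).mulVec (x T) =
      x₀ + ∫ s in (0 : ℝ)..T, (expMat A (-s)).mulVec (ψ s) := by
    ext i
    rw [key i, Pi.add_apply, integral_apply hEψ]
  rw [convExp_eq A hψ, ← Matrix.mulVec_add, ← key2, Matrix.mulVec_mulVec, expMat_mul_neg,
    Matrix.one_mulVec]

end VariationOfConstants

/-! ## Invariance by Picard iteration -/

section Picard

variable {n : ℕ}

lemma norm_mulVec_le (M : Matrix (Fin n) (Fin n) ℝ) (v : Fin n → ℝ) :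
    ‖M.mulVec v‖ ≤ (∑ i, ∑ j, |M i j|) * ‖v‖ := by
  refine (pi_norm_le_iff_of_nonneg (by positivity)).2 fun i => ?_
  rw [Real.norm_eq_abs, Matrix.mulVec, dotProduct]
  calc |∑ j, M i j * v j| ≤ ∑ j, |M i j| * ‖v‖ := by
        refine (Finset.abs_sum_le_sum_abs _ _).trans (Finset.sum_le_sum fun j _ => ?_)
        rw [abs_mul]
        exact mul_le_mul_of_nonneg_left (norm_le_pi_norm v j) (abs_nonneg _)
    _ = (∑ j, |M i j|) * ‖v‖ := by rw [Finset.sum_mul]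
    _ ≤ _ := by
      refine mul_le_mul_of_nonneg_right ?_ (norm_nonneg v)
      exact Finset.single_le_sum (f := fun i => ∑ j, |M i j|)
        (fun i _ => Finset.sum_nonneg fun j _ => abs_nonneg _) (Finset.mem_univ i)

/-- The bound keeps `g` under the integral, because the Picard estimate inserts an exponential
weight there. -/
lemma exists_norm_convExp_sub_le (A : Matrix (Fin n) (Fin n) ℝ) (r : ℝ) :
    ∃ C, 0 ≤ C ∧ ∀ t ∈ Icc 0 r, ∀ (φ ψ : ℝ → Fin n → ℝ) (g : ℝ → ℝ), Continuous g →
      IntervalIntegrable φ volume 0 t → IntervalIntegrable ψ volume 0 t →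
      (∀ s ∈ Icc 0 t, ‖φ s - ψ s‖ ≤ g s) →
      ‖convExp A φ t - convExp A ψ t‖ ≤ C * ∫ s in (0 : ℝ)..t, g s := by
  have hcont : Continuous fun t => ∑ i, ∑ j, |expMat A t i j| := by
    have := fun i j => (continuous_expMat A).matrix_elem i j
    fun_prop
  obtain ⟨C, hC⟩ := (isCompact_Icc (a := (0 : ℝ)) (b := r)).exists_bound_of_continuousOn
    hcont.continuousOn
  refine ⟨|C|, abs_nonneg _, fun t ht φ ψ g hg hφ hψ hle => ?_⟩
  have hM : Continuous fun s => expMat A (t - s) := (continuous_expMat A).comp (by fun_prop)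
  unfold convExp
  rw [← intervalIntegral.integral_sub (intervalIntegrable_mulVec hM hφ)
    (intervalIntegrable_mulVec hM hψ), ← intervalIntegral.integral_const_mul]
  refine intervalIntegral.norm_integral_le_of_norm_le ht.1 (ae_of_all _ fun s hs => ?_)
    ((hg.const_mul _).intervalIntegrable _ _)
  rw [← Matrix.mulVec_sub]
  refine (norm_mulVec_le _ _).trans ?_
  have h1 := hC (t - s) ⟨by linarith [hs.2], by linarith [hs.1, ht.2]⟩
  rw [Real.norm_eq_abs] at h1
  exact mul_le_mul (((le_abs_self _).trans h1).trans (le_abs_self C)) (hle s ⟨hs.1.le, hs.2⟩)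
    (norm_nonneg _) (abs_nonneg _)

/-- A solution stays in a closed set that is invariant under the Picard map of the equation. -/
lemma mem_of_picard_invariant (A : Matrix (Fin n) (Fin n) ℝ) {G : ℝ → (Fin n → ℝ) → Fin n → ℝ}
    {x₀ : Fin n → ℝ} {r L : ℝ} {K Q : Set (Fin n → ℝ)} (hK : IsClosed K) (hx₀ : x₀ ∈ K)
    (hKQ : K ⊆ Q)
    (hG : ∀ y : ℝ → Fin n → ℝ, Continuous y →
      ∀ a b, IntervalIntegrable (fun s => G s (y s)) volume a b)
    (hL0 : 0 ≤ L) (hL : ∀ s, ∀ a ∈ Q, ∀ b ∈ Q, ‖G s a - G s b‖ ≤ L * ‖a - b‖)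
    {x : ℝ → Fin n → ℝ} (hx : Continuous x) (hxQ : ∀ t ∈ Icc 0 r, x t ∈ Q)
    (hsol : ∀ t ∈ Icc 0 r, x t = (expMat A t).mulVec x₀ + convExp A (fun s => G s (x s)) t)
    (hinv : ∀ y : ℝ → Fin n → ℝ, Continuous y → (∀ t ∈ Icc 0 r, y t ∈ K) →
      ∀ t ∈ Icc 0 r, (expMat A t).mulVec x₀ + convExp A (fun s => G s (y s)) t ∈ K) :
    ∀ t ∈ Icc 0 r, x t ∈ K := by
  obtain ⟨C, hC0, hC⟩ := exists_norm_convExp_sub_le A r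
  obtain ⟨D, hD⟩ := (isCompact_Icc (a := (0 : ℝ)) (b := r)).exists_bound_of_continuousOn
    (f := fun t => x₀ - x t) (by fun_prop)
  -- In the weight `exp (2 M t)`, integration gains `1 / (2 M)`, so one iteration contracts by `C L
  -- / (2 M) ≤ 1/2` on all of `[0, r]`, however long the step.
  set M := C * L + 1 with hM
  have hM0 : 0 < M := by positivity
  have hiter : ∀ k : ℕ, ∃ y : ℝ → Fin n → ℝ, Continuous y ∧ (∀ t ∈ Icc 0 r, y t ∈ K) ∧
      ∀ t ∈ Icc 0 r, ‖y t - x t‖ ≤ |D| * (1 / 2) ^ k * Real.exp (2 * M * t) := by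
    intro k
    induction k with
    | zero =>
      refine ⟨fun _ => x₀, continuous_const, fun _ _ => hx₀, fun t ht => ?_⟩
      refine (hD t ht).trans ((le_abs_self D).trans ?_)
      rw [pow_zero, mul_one]
      refine le_mul_of_one_le_right (abs_nonneg _) (Real.one_le_exp ?_)
      have := ht.1
      positivity
    | succ k ih =>
      obtain ⟨y, hy, hyK, hyx⟩ := ih
      refine ⟨fun t => (expMat A t).mulVec x₀ + convExp A (fun s => G s (y s)) t, ?_,
        hinv y hy hyK, fun t ht => ?_⟩
      · exact ((continuous_expMat A).matrix_mulVec continuous_const).add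
          (continuous_convExp A (hG y hy))
      · have hsub : Icc 0 t ⊆ Icc 0 r := Icc_subset_Icc_right ht.2
        rw [hsol t ht, add_sub_add_left_eq_sub]
        have h1 := hC t ht (fun s => G s (y s)) (fun s => G s (x s))
          (fun s => L * (|D| * (1 / 2) ^ k * Real.exp (2 * M * s))) (by fun_prop)
          (hG y hy 0 t) (hG x hx 0 t) (fun s hs =>
            (hL s _ (hKQ (hyK s (hsub hs))) _ (hxQ s (hsub hs))).trans
              (mul_le_mul_of_nonneg_left (hyx s (hsub hs)) hL0))
        refine h1.trans ?_
        have hint : ∫ s in (0 : ℝ)..t, Real.exp (2 * M * s) =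
            (Real.exp (2 * M * t) - 1) / (2 * M) := by
          rw [intervalIntegral.integral_comp_mul_left (fun s => Real.exp s) (by positivity),
            integral_exp]
          simp
          field_simp
        rw [intervalIntegral.integral_const_mul, intervalIntegral.integral_const_mul, hint]
        have h2 : (Real.exp (2 * M * t) - 1) / (2 * M) ≤ Real.exp (2 * M * t) / (2 * M) := by
          gcongr
          linarith
        calc C * (L * (|D| * (1 / 2) ^ k * ((Real.exp (2 * M * t) - 1) / (2 * M))))
            ≤ C * (L * (|D| * (1 / 2) ^ k * (Real.exp (2 * M * t) / (2 * M)))) := by gcongr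
          _ = (C * L / M) * (|D| * (1 / 2) ^ (k + 1) * Real.exp (2 * M * t)) := by
            field_simp
            ring
          _ ≤ 1 * (|D| * (1 / 2) ^ (k + 1) * Real.exp (2 * M * t)) := by
            gcongr
            rw [div_le_one hM0]
            linarith
          _ = _ := one_mul _
  intro t ht
  choose y _ hyK hyx using hiter
  refine hK.mem_of_tendsto (b := Filter.atTop) (f := fun k => y k t) ?_
    (Filter.Eventually.of_forall fun k => hyK k t ht)
  rw [tendsto_iff_norm_sub_tendsto_zero]
  refine squeeze_zero (fun _ => norm_nonneg _) (fun k => hyx k t ht) ?_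
  have h := ((tendsto_pow_atTop_nhds_zero_of_lt_one (r := (1 / 2 : ℝ)) (by norm_num)
    (by norm_num)).const_mul |D|).mul_const (Real.exp (2 * M * t))
  simpa using h

end Picard

/-! ## Soundness of one time step -/

section Step

variable {n m : ℕ} {π : Type} [Fintype π]

/-- The part of the dynamics that is constant over a time step, with the input at the center. -/
noncomputable def staticPoint (P : Problem n m) (zs : Fin n ⊕ Fin m → ℝ) (x₀ : Fin n → ℝ) :
    Fin n → ℝ :=
  (1 / 2 : ℝ) • quadForm (taylor P.f zs).D (Sum.elim x₀ P.U.center) (Sum.elim x₀ P.U.center) +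
    ((taylor P.f zs).w + (taylor P.f zs).B.mulVec P.U.center)

lemma staticPoint_mem (P : Problem n m) (zs : Fin n ⊕ Fin m → ℝ) {R : PolyZonotope (Fin n) π}
    {α : π → ℝ} (hα : α ∈ Icc (-1 : π → ℝ) 1) {x₀ : Fin n → ℝ} (hx₀ : x₀ ∈ R.eval α) :
    staticPoint P zs x₀ ∈ (staticInputs P zs R).eval α :=
  PolyZonotope.add_mem_translate (PolyZonotope.smul_mem_smul (PolyZonotope.quadForm_mem_sq _ hα
    (PolyZonotope.elim_mem_prodZonotope hx₀ P.U.center_mem)) _) _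

lemma mem_varInputs {Z ZΔ : Zonotope (Fin n ⊕ Fin m)} {UΔ : Zonotope (Fin m)}
    (B : Matrix (Fin n) (Fin m) ℝ) (D : Fin n → Matrix (Fin n ⊕ Fin m) (Fin n ⊕ Fin m) ℝ)
    {z zΔ : Fin n ⊕ Fin m → ℝ} {uΔ : Fin m → ℝ} (hz : z ∈ Z.toSet) (hzΔ : zΔ ∈ ZΔ.toSet)
    (huΔ : uΔ ∈ UΔ.toSet) :
    B.mulVec uΔ + (1 / 2 : ℝ) • (quadForm D z zΔ + quadForm D zΔ z + quadForm D zΔ zΔ) ∈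
      (varInputs Z ZΔ UΔ B D).toSet := by
  -- The quadratic map is used without dependent factors, so the factor vector is the empty
  -- function.
  have hE : (fun e => e.elim : Empty → ℝ) ∈ Icc (-1 : Empty → ℝ) 1 :=
    ⟨fun e => e.elim, fun e => e.elim⟩
  have hsq := PolyZonotope.eval_subset_zono _ hE (PolyZonotope.quadForm_mem_sq D hE
    (P := PolyZonotope.ofZonotope ZΔ) (x := zΔ) (by
      rw [PolyZonotope.eval_ofZonotope]; exact hzΔ))
  exact Zonotope.add_mem_add (Zonotope.mulVec_mem_mulMat huΔ B) (Zonotope.smul_mem_smul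
    (Zonotope.add_mem_add (Zonotope.add_mem_add (Zonotope.quadForm_mem_bilin D hz hzΔ)
      (Zonotope.quadForm_mem_bilin D hzΔ hz)) hsq) _)

/-- The set of abstraction errors is an enclosure wherever the deviation of the state from the
beginning of the step lies in the set computed for it. -/
lemma sub_staticPoint_mem_abstrErr (P : Problem n m) (hf : ContDiff ℝ 3 P.f)
    (zs : Fin n ⊕ Fin m → ℝ) {R : PolyZonotope (Fin n) π} (Ψbar : Zonotope (Fin n)) {α : π → ℝ}
    (hα : α ∈ Icc (-1 : π → ℝ) 1) {x₀ : Fin n → ℝ} (hx₀ : x₀ ∈ R.eval α) {x : Fin n → ℝ}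
    (hx : x - x₀ ∈ (postDelta R Ψbar (taylor P.f zs).A P.eta P.r).toSet) {u : Fin m → ℝ}
    (hu : u ∈ P.U.toSet) :
    P.f (Sum.elim x u) - (taylor P.f zs).A.mulVec x - staticPoint P zs x₀ ∈
      (abstrErr P zs R Ψbar).toSet := by
  set T := taylor P.f zs with hT
  set z : Fin n ⊕ Fin m → ℝ := Sum.elim x u with hz
  set z₀ : Fin n ⊕ Fin m → ℝ := Sum.elim x₀ P.U.center with hz₀
  set zΔ : Fin n ⊕ Fin m → ℝ := Sum.elim (x - x₀) (u - P.U.center) with hzΔ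
  have hsum : z = z₀ + zΔ := by
    ext (i | i) <;> simp [hz, hz₀, hzΔ]
  have huΔ := Zonotope.sub_center_mem_centered hu
  have hzΔm := Zonotope.elim_mem_prod hx huΔ
  have hvar := mem_varInputs T.B T.D
    (Zonotope.elim_mem_prod (PolyZonotope.eval_subset_zono _ hα hx₀) P.U.center_mem) hzΔm huΔ
  have hzR : z ∈ (((R.prodZonotope ⟨P.U.center, []⟩).addZonotope
      ((postDelta R Ψbar T.A P.eta P.r).prod P.U.centered)).zono).toSet := by
    refine PolyZonotope.eval_subset_zono _ hα ?_
    rw [hsum]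
    exact PolyZonotope.add_mem_addZonotope (PolyZonotope.elim_mem_prodZonotope hx₀
      (Zonotope.center_mem ⟨P.U.center, []⟩)) hzΔm
  have hlag := mem_lagrangeRemainder (E := T.E) (fun i j k l => continuous_partial3 hf i j k l)
    (zs := zs) hzR (y := P.f z - (T.w + T.A.mulVec x + T.B.mulVec u +
      (1 / 2 : ℝ) • quadForm T.D z z)) (fun i => exists_taylor_remainder hf zs x u i)
  have h := Zonotope.add_mem_add hvar hlag
  -- Expanding the quadratic form about `z₀` moves everything but its value at `z₀` and `B` at the
  -- input center into the error.
  have e : P.f z - T.A.mulVec x - staticPoint P zs x₀ =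
      T.B.mulVec (u - P.U.center) +
        (1 / 2 : ℝ) • (quadForm T.D z₀ zΔ + quadForm T.D zΔ z₀ + quadForm T.D zΔ zΔ) +
      (P.f z - (T.w + T.A.mulVec x + T.B.mulVec u + (1 / 2 : ℝ) • quadForm T.D z z)) := by
    have hq : quadForm T.D z z = quadForm T.D z₀ z₀ +
        (quadForm T.D z₀ zΔ + quadForm T.D zΔ z₀ + quadForm T.D zΔ zΔ) := by
      rw [hsum, quadForm_add_left, quadForm_add_right, quadForm_add_right]
      abel
    rw [hq, Matrix.mulVec_sub]
    simp only [staticPoint, ← hT, ← hz₀]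
    module
  rw [e]
  exact h

/-- The case `t = 0` of `mem_postDelta`; it puts `x₀` itself into the invariant set, where Picard
iteration starts. -/
lemma zero_mem_postDelta (R : PolyZonotope (Fin n) π) (Ψ : Zonotope (Fin n))
    (A : Matrix (Fin n) (Fin n) ℝ) (η : ℕ) {r : ℝ} (hr : 0 < r) :
    (0 : Fin n → ℝ) ∈ (postDelta R Ψ A η r).toSet := by
  have h := mem_postDelta R Ψ A η hr (t := 0) ⟨le_rfl, hr.le⟩ R.zono.center_mem
    (ψ := fun _ => Ψ.center) (by simp) (fun _ _ => Ψ.center_mem)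
  simpa [expMat_zero, convExp] using h

/-- The arguments stay in a compact set over a bounded interval, so the integrand is measurable and
bounded. -/
lemma intervalIntegrable_dynamics {f : (Fin n ⊕ Fin m → ℝ) → Fin n → ℝ} (hf : Continuous f)
    {U : Set (Fin m → ℝ)} (hU : IsCompact U) {u : ℝ → Fin m → ℝ} (hu : Measurable u)
    (huU : ∀ t, u t ∈ U) {y : ℝ → Fin n → ℝ} (hy : Continuous y) (a b : ℝ) :
    IntervalIntegrable (fun s => f (Sum.elim (y s) (u s))) volume a b := by
  have hz : Measurable fun s => (Sum.elim (y s) (u s) : Fin n ⊕ Fin m → ℝ) := by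
    refine measurable_pi_lambda _ ?_
    rintro (i | i)
    · exact (measurable_pi_apply i).comp hy.measurable
    · exact (measurable_pi_apply i).comp hu
  have hcomp : IsCompact ((fun p : (Fin n → ℝ) × (Fin m → ℝ) =>
      f (Sum.elim p.1 p.2 : Fin n ⊕ Fin m → ℝ)) '' ((y '' uIcc a b) ×ˢ U)) := by
    refine ((isCompact_uIcc.image hy).prod hU).image (hf.comp ?_)
    refine continuous_pi ?_
    rintro (i | i) <;> simp only [Sum.elim_inl, Sum.elim_inr] <;> fun_prop
  obtain ⟨C, hC⟩ := hcomp.isBounded.exists_norm_le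
  refine (intervalIntegrable_const (c := C)).mono_fun
    (hf.measurable.comp hz).aestronglyMeasurable ?_
  filter_upwards [ae_restrict_mem measurableSet_uIoc] with s hs
  refine (hC _ ⟨(y s, u s), ⟨mem_image_of_mem y (uIoc_subset_uIcc hs), huU s⟩, rfl⟩).trans ?_
  exact le_abs_self C

/-- The body of the while loop propagates solutions, for every value of the dependent factors. -/
lemma Post.solution_mem {P : Problem n m} (hf : ContDiff ℝ 3 P.f) (hr : 0 < P.r)
    {zs : Fin n ⊕ Fin m → ℝ} {Ψ₀ R R' : PolyZonotope (Fin n) π} (hpost : Post P zs Ψ₀ R R')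
    {α : π → ℝ} (hα : α ∈ Icc (-1 : π → ℝ) 1) {x₀ : Fin n → ℝ} (hx₀ : x₀ ∈ R.eval α)
    {u : ℝ → Fin m → ℝ} (hu : Measurable u) (huU : ∀ t, u t ∈ P.U.toSet) {x : ℝ → Fin n → ℝ}
    (hx : Continuous x)
    (hsol : ∀ t ∈ Icc 0 P.r, x t = x₀ + ∫ s in (0 : ℝ)..t, P.f (Sum.elim (x s) (u s))) :
    x P.r ∈ R'.eval α := by
  obtain ⟨k, ⟨hincl, -⟩, rfl⟩ := hpost
  set Ψbar := (errIter P zs R Ψ₀ k).enlarge P.lam with hΨbar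
  set A := (taylor P.f zs).A with hA
  set v₀ := staticPoint P zs x₀ with hv₀
  set K : Set (Fin n → ℝ) := (fun y => x₀ + y) '' (postDelta R Ψbar A P.eta P.r).toSet with hK
  have hmemK : ∀ a, a ∈ K ↔ a - x₀ ∈ (postDelta R Ψbar A P.eta P.r).toSet := by
    intro a
    constructor
    · rintro ⟨y, hy, rfl⟩
      simpa using hy
    · intro h
      exact ⟨_, h, by simp⟩
  have hKc : IsCompact K := (Zonotope.isCompact_toSet _).image (by fun_prop)
  have herr : ∀ a ∈ K, ∀ s, P.f (Sum.elim a (u s)) - A.mulVec a - v₀ ∈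
      (abstrErr P zs R Ψbar).toSet := fun a ha s =>
    sub_staticPoint_mem_abstrErr P hf zs Ψbar hα hx₀ ((hmemK a).1 ha) (huU s)
  have hv₀m : v₀ ∈ (staticInputs P zs R).eval α := staticPoint_mem P zs hα hx₀
  have hbar : ∀ a ∈ K, ∀ s, P.f (Sum.elim a (u s)) - A.mulVec a ∈ Ψbar.toSet := by
    intro a ha s
    -- The stopping condition enters here: on `K` the full input `v₀` plus error lies in the set
    -- `Ψbar` from which `K` was built.
    refine hincl (PolyZonotope.subset_toSet _ hα ?_)
    have h := PolyZonotope.add_mem_addZonotope hv₀m (herr a ha s)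
    rwa [add_sub_cancel] at h
  have hx₀z := PolyZonotope.eval_subset_zono _ hα hx₀
  set G : ℝ → (Fin n → ℝ) → Fin n → ℝ := fun s a => P.f (Sum.elim a (u s)) - A.mulVec a with hGdef
  have hfi := fun y (hy : Continuous y) a b =>
    intervalIntegrable_dynamics hf.continuous P.U.isCompact_toSet hu huU (y := y) hy a b
  have hG : ∀ y : ℝ → Fin n → ℝ, Continuous y →
      ∀ a b, IntervalIntegrable (fun s => G s (y s)) volume a b := fun y hy a b =>
    (hfi y hy a b).sub ((continuous_const.matrix_mulVec hy).intervalIntegrable _ _)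
  have hvar : ∀ t ∈ Icc 0 P.r,
      x t = (expMat A t).mulVec x₀ + convExp A (fun s => G s (x s)) t := fun t ht =>
    eq_expMat_mulVec_add_convExp A ht.1 hx (hfi x hx 0 t)
      fun s hs => hsol s ⟨hs.1, hs.2.trans ht.2⟩
  -- A ball around both `K` and the trajectory supplies a convex compact domain for the Lipschitz
  -- constant before the solution is known to stay in `K`.
  obtain ⟨ρ, hρ⟩ := ((hKc.isBounded.union
    (isCompact_Icc.image hx : IsCompact (x '' Icc 0 P.r)).isBounded)).exists_norm_le
  obtain ⟨σ, hσ⟩ := P.U.isCompact_toSet.isBounded.exists_norm_le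
  set Q : Set (Fin n → ℝ) := Metric.closedBall 0 ρ with hQ
  obtain ⟨L, hL⟩ := hf.contDiffOn.exists_lipschitzOnWith (s := Metric.closedBall 0 (max ρ σ))
    (by norm_num) (convex_closedBall _ _) (isCompact_closedBall _ _)
  have hzball : ∀ a ∈ Q, ∀ s, (Sum.elim a (u s) : Fin n ⊕ Fin m → ℝ) ∈
      Metric.closedBall (0 : Fin n ⊕ Fin m → ℝ) (max ρ σ) := by
    intro a ha s
    rw [hQ, mem_closedBall_zero_iff] at ha
    rw [mem_closedBall_zero_iff]
    have hσ0 := (norm_nonneg _).trans (hσ _ (huU s))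
    refine (pi_norm_le_iff_of_nonneg (le_max_of_le_right hσ0)).2 ?_
    rintro (i | i)
    · exact (norm_le_pi_norm a i).trans (ha.trans (le_max_left _ _))
    · exact (norm_le_pi_norm (u s) i).trans ((hσ _ (huU s)).trans (le_max_right _ _))
  have hGL : ∀ s, ∀ a ∈ Q, ∀ b ∈ Q,
      ‖G s a - G s b‖ ≤ (L + ∑ i, ∑ j, |A i j|) * ‖a - b‖ := by
    intro s a ha b hb
    have h1 := hL.norm_sub_le (hzball a ha s) (hzball b hb s)
    have h2 : ‖(Sum.elim a (u s) : Fin n ⊕ Fin m → ℝ) - Sum.elim b (u s)‖ ≤ ‖a - b‖ := by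
      refine (pi_norm_le_iff_of_nonneg (norm_nonneg _)).2 ?_
      rintro (i | i)
      · exact norm_le_pi_norm (a - b) i
      · simp
    have h3 := norm_mulVec_le A (a - b)
    calc ‖G s a - G s b‖ = ‖(P.f (Sum.elim a (u s)) - P.f (Sum.elim b (u s))) -
          A.mulVec (a - b)‖ := by
          rw [Matrix.mulVec_sub]
          congr 1
          simp only [hGdef]
          abel
      _ ≤ ‖P.f (Sum.elim a (u s)) - P.f (Sum.elim b (u s))‖ + ‖A.mulVec (a - b)‖ :=
          norm_sub_le _ _
      _ ≤ L * ‖a - b‖ + (∑ i, ∑ j, |A i j|) * ‖a - b‖ :=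
          add_le_add (h1.trans (mul_le_mul_of_nonneg_left h2 L.2)) h3
      _ = _ := by ring
  have hxK : ∀ t ∈ Icc 0 P.r, x t ∈ K := by
    refine mem_of_picard_invariant A hKc.isClosed (x₀ := x₀) ?_ (Q := Q) ?_ hG (by positivity)
      hGL hx ?_ hvar ?_
    · rw [hmemK, sub_self]
      exact zero_mem_postDelta R Ψbar A P.eta hr
    · intro a ha
      exact mem_closedBall_zero_iff.2 (hρ a (Or.inl ha))
    · intro t ht
      exact mem_closedBall_zero_iff.2 (hρ _ (Or.inr (mem_image_of_mem x ht)))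
    · intro y hy hyK t ht
      rw [hmemK]
      exact mem_postDelta R Ψbar A P.eta hr ht hx₀z (hG y hy 0 t)
        fun s hs => hbar _ (hyK s ⟨hs.1, hs.2.trans ht.2⟩) s
  have hrr : P.r ∈ Icc 0 P.r := ⟨hr.le, le_rfl⟩
  have hGΔ : IntervalIntegrable (fun s => G s (x s) - v₀) volume 0 P.r :=
    (hG x hx 0 P.r).sub intervalIntegrable_const
  -- At the full step `t = r` the scaling condition is trivial, so the error set need not contain
  -- the origin.
  have hin := convExp_mem_inputSolution A P.eta hr hrr hGΔ
    (fun s hs => herr _ (hxK s hs) s) (fun p hp i => by simpa [hr.ne'] using hp)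
  have hsplit : convExp A (fun s => G s (x s)) P.r = (gammaMat A P.r).mulVec v₀ +
      convExp A (fun s => G s (x s) - v₀) P.r := by
    rw [gammaMat_mulVec, ← convExp_add A intervalIntegrable_const hGΔ]
    congr 1
    ext s
    simp
  rw [hvar _ hrr, hsplit, ← add_assoc]
  exact PolyZonotope.eval_subset_reduce _ _ hα (PolyZonotope.add_mem_addZonotope
    (PolyZonotope.add_mem_exactAdd (PolyZonotope.mulVec_mem_mulMat hx₀ _)
      (PolyZonotope.mulVec_mem_mulMat hv₀m _)) hin)

/-- Soundness after every completed step of the algorithm. -/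
lemma Steps.solution_mem {P : Problem n m} (hf : ContDiff ℝ 3 P.f) (hr : 0 < P.r) {N : ℕ}
    (htf : P.tf = N * P.r) {X₀ : PolyZonotope (Fin n) π} {Ψ₀ : ℕ → PolyZonotope (Fin n) π}
    {zs : ℕ → Fin n ⊕ Fin m → ℝ} {α : π → ℝ} (hα : α ∈ Icc (-1 : π → ℝ) 1) {x₀ : Fin n → ℝ}
    (hx₀ : x₀ ∈ X₀.eval α) {u : ℝ → Fin m → ℝ} (hu : Measurable u)
    (huU : ∀ t, u t ∈ P.U.toSet) {x : ℝ → Fin n → ℝ} (hx : Continuous x)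
    (hsol : ∀ t ∈ Icc 0 P.tf, x t = x₀ + ∫ s in (0 : ℝ)..t, P.f (Sum.elim (x s) (u s)))
    {s : ℕ} {R : PolyZonotope (Fin n) π} (hs : Steps P X₀ Ψ₀ zs s R) :
    s ≤ N ∧ x (s * P.r) ∈ R.eval α := by
  induction hs with
  | init =>
    refine ⟨Nat.zero_le _, ?_⟩
    have h := hsol 0 ⟨le_rfl, by rw [htf]; positivity⟩
    simp only [Nat.cast_zero, zero_mul, h, intervalIntegral.integral_same, add_zero]
    exact hx₀
  | @step s R R' _ hlt hpost ih =>
    have hsN : s + 1 ≤ N := by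
      rw [htf] at hlt
      exact_mod_cast lt_of_mul_lt_mul_right hlt hr.le
    refine ⟨hsN, ?_⟩
    have hsN' : ((s : ℝ) + 1) * P.r ≤ P.tf := by
      rw [htf]
      gcongr
      exact_mod_cast hsN
    have hsr : 0 ≤ (s : ℝ) * P.r := by positivity
    -- The dynamics is autonomous: shifting time by `s r` gives a solution that starts from the
    -- state reached so far.
    have h := hpost.solution_mem hf hr hα ih.2 (u := fun t => u (t + s * P.r))
      (hu.comp (measurable_id.add_const _)) (fun t => huU _) (x := fun t => x (t + s * P.r))
      (by fun_prop) (fun t ht => by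
        have hfi := intervalIntegrable_dynamics hf.continuous P.U.isCompact_toSet hu huU hx
        rw [hsol (t + s * P.r) ⟨by linarith [ht.1], by linarith [ht.2]⟩,
          hsol (s * P.r) ⟨hsr, by linarith [ht.2]⟩,
          intervalIntegral.integral_comp_add_right (fun τ => P.f (Sum.elim (x τ) (u τ))),
          zero_add, add_assoc, intervalIntegral.integral_add_adjacent_intervals (hfi _ _)
            (hfi _ _)])
    convert h using 2
    push_cast
    ring

end Step

end ConsPoly

/-! ### Soundness over the whole time horizon. -/

theorem theorem1 {n m p : ℕ} (P : ConsPoly.Problem n m) (hf : ContDiff ℝ 3 P.f)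
    (hr : 0 < P.r) (htf : ∃ N : ℕ, P.tf = N * P.r)
    (X₀ : ConsPoly.PolyZonotope (Fin n) (Fin p))
    (zs : ℕ → Fin n ⊕ Fin m → ℝ)
    (R : ConsPoly.PolyZonotope (Fin n) (Fin p))
    (hR : ConsPoly.Reach P X₀ (fun _ => ConsPoly.PolyZonotope.origin) zs R)
    (α : Fin p → ℝ) (hα : α ∈ Set.Icc (-1 : Fin p → ℝ) 1)
    (x₀ : Fin n → ℝ) (hx₀ : x₀ ∈ X₀.eval α) :
    ConsPoly.exactReach P.f P.U.toSet {x₀} P.tf ⊆ R.eval α := by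
  obtain ⟨N, hN⟩ := htf
  rintro y ⟨x₁, hx₁, u, x, hu, huU, ⟨hxc, hsol⟩, rfl⟩
  rw [show x₁ = x₀ from hx₁] at hsol
  have htf0 : 0 ≤ P.tf := by rw [hN]; positivity
  -- Input and state are prescribed on `[0, tf]` only. Extending the input by the center of the
  -- input set and the state by its end values gives globally admissible functions with the same
  -- integrals on `[0, tf]`.
  set u' : ℝ → Fin m → ℝ := fun t => if t ∈ Icc 0 P.tf then u t else P.U.center with hu'
  set x' : ℝ → Fin n → ℝ := IccExtend htf0 (domRestrict (Icc 0 P.tf) x) with hx'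
  have hx'c : Continuous x' := (continuousOn_iff_continuous_domRestrict.1 hxc).Icc_extend'
  have hx'x : ∀ t ∈ Icc 0 P.tf, x' t = x t := fun t ht => IccExtend_of_mem _ _ ht
  have hu'm : Measurable u' := Measurable.ite measurableSet_Icc hu measurable_const
  have hu'U : ∀ t, u' t ∈ P.U.toSet := by
    intro t
    by_cases ht : t ∈ Icc 0 P.tf
    · simpa only [hu', if_pos ht] using huU t ht
    · simpa only [hu', if_neg ht] using P.U.center_mem
  have hsol' : ∀ t ∈ Icc 0 P.tf,
      x' t = x₀ + ∫ s in (0 : ℝ)..t, P.f (Sum.elim (x' s) (u' s)) := by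
    intro t ht
    rw [hx'x t ht, hsol t ht]
    congr 1
    refine intervalIntegral.integral_congr fun s hs => ?_
    rw [uIcc_of_le ht.1] at hs
    have hs' : s ∈ Icc 0 P.tf := ⟨hs.1, hs.2.trans ht.2⟩
    simp only [hx'x s hs', hu', if_pos hs']
  obtain ⟨s, hs, hend⟩ := hR
  obtain ⟨hsN, hmem⟩ := hs.solution_mem hf hr hN hα hx₀ hu'm hu'U hx'c hsol'
  -- The exit condition rules out `s < N`, so the final set belongs to time `tf` exactly.
  have hsN' : s = N := by
    refine le_antisymm hsN (not_lt.1 fun hlt => hend ?_)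
    rw [hN]
    gcongr
  rw [hsN', ← hN, hx'x _ ⟨htf0, le_rfl⟩] at hmem
  exact hmem
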